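/- Let $\alpha>0$, $\sigma,c_2\in\mathbb R$, and let $m=m_n$ be positive integers with $m_n/n\to\alpha$ (for instance $m=\alpha n$). Let $A\in\mathbb R^{m\times n}$ and $\mathbf v\in\mathbb R^m$ have i.i.d. standard normal entries, all independent, and let $\mathbf x_{sol}=\frac1{\sqrt n}(1,\dots,1)^T\in\mathbb R^n$. For $c_1\in\mathbb R$ put $$\xi_p(\alpha,\sigma;c_2,c_1)=\liminf_{n\to\infty}\frac1{\sqrt n}\,\mathbb E\min_{\mathbf x}\max_{\|\lambda\|_2=1}\lambda^T\Big([A\ \mathbf v]\begin{bmatrix}\mathbf x_{sol}-\mathbf x\\ \sigma\end{bmatrix}\Big),$$ where the minimum is over all $\mathbf x\in\big[-\frac1{\sqrt n},\frac1{\sqrt n}\big]^n$ with $\mathbf x_{sol}^T\mathbf x=c_1$ and $\|\mathbf x\|_2^2=c_2$ and equals $+\infty$ if there is no such $\mathbf x$; if the limit exists, $\xi_p$ is that limit. For $\gamma,\nu\in\mathbb R$ put $$\xi_{RD}(\alpha,\sigma;c_2,c_1,\gamma,\nu)=\sqrt\alpha\,\sqrt{1-2c_1+c_2+\sigma^2}+I_{22}-I_1+I_{21}-\nu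 c_1-\gamma c_2,$$ where $$I_{22}=\tfrac12(\nu+\gamma)\,\mathrm{erfc}\Big(\tfrac{\nu+2\gamma}{\sqrt2}\Big)-\frac{e^{-(\nu+2\gamma)^2/2}}{\sqrt{2\pi}},\qquad I_{21}=-\tfrac12(\nu-\gamma)\Big(\mathrm{erf}\Big(\tfrac{\nu-2\gamma}{\sqrt2}\Big)+1\Big)-\frac{e^{-(\nu-2\gamma)^2/2}}{\sqrt{2\pi}},$$ $$I_1=\frac{\sqrt{\pi/2}\,(\nu^2+1)\Big(\mathrm{erf}\big(\tfrac{2\gamma-\nu}{\sqrt2}\big)+\mathrm{erf}\big(\tfrac{2\gamma+\nu}{\sqrt2}\big)\Big)+e^{-(\nu+2\gamma)^2/2}(\nu-2\gamma)-e^{-(\nu-2\gamma)^2/2}(\nu+2\gamma)}{4\sqrt{2\pi}\,\gamma},$$ with $I_1=0$ (its limit) at $\gamma=0$; when $1-2c_1+c_2+\sigma^2<0$, in which case no $\mathbf x$ is admissible, the square root is read as $0$. Then, in $[-\infty,+\infty]$, $$\xi_p(\alpha,\sigma;c_2,c_1)\ \ge\ \sup_{\gamma,\nu\in\mathbb R}\xi_{RD}(\alpha,\sigma;c_2,c_1,\gamma,\nu)\qquad\text{for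 every }c_1\in\mathbb R,$$ and consequently, for every set $C\subseteq\mathbb R$ of values of $c_1$, $$\inf_{c_1\in C}\xi_p(\alpha,\sigma;c_2,c_1)\ \ge\ \inf_{c_1\in C}\ \sup_{\gamma,\nu\in\mathbb R}\xi_{RD}(\alpha,\sigma;c_2,c_1,\gamma,\nu).$$ -/

import Mathlib

open MeasureTheory ProbabilityTheory Filter Topology
open scoped ENNReal Matrix

/-- The law of an `m × n` array of independent standard normal variables. -/
noncomputable def gaussMatrix (m n : ℕ) : Measure (Fin m → Fin n → ℝ) :=
  Measure.pi fun _ => Measure.pi fun _ => gaussianReal 0 1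

/-- The law of an `m`-dimensional vector of independent standard normal variables. -/
noncomputable def gaussVector (m : ℕ) : Measure (Fin m → ℝ) :=
  Measure.pi fun _ => gaussianReal 0 1

/-- The transmitted vector, all of whose components are `1 / √n`. -/
noncomputable def xSol (n : ℕ) : Fin n → ℝ := fun _ => 1 / √(n : ℝ)

/-- The vectors `x ∈ [-1/√n, 1/√n]ⁿ` with `x_solᵀ x = c₁` and `‖x‖₂² = c₂`. -/
def feasibleSet (n : ℕ) (c₂ c₁ : ℝ) : Set (Fin n → ℝ) :=
  {x | (∀ i, x i ∈ Set.Icc (-(1 / √(n : ℝ))) (1 / √(n : ℝ))) ∧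
    xSol n ⬝ᵥ x = c₁ ∧ x ⬝ᵥ x = c₂}

/-- `max_{‖l‖₂ = 1} lᵀ w`, for `w ∈ ℝᵐ`. -/
noncomputable def maxUnit {m : ℕ} (w : Fin m → ℝ) : ℝ :=
  ⨆ l : {l : Fin m → ℝ // l ⬝ᵥ l = 1}, (l : Fin m → ℝ) ⬝ᵥ w

/-- `min_x max_{‖l‖₂ = 1} lᵀ [A v] [x_sol - x; σ]` over the feasible `x`.
The inner maximum is nonnegative, so nothing is lost by taking values in `[0, ∞]`; the minimum
over an empty feasible set is `∞`. -/
noncomputable def minMaxResidual {m n : ℕ} (σ c₂ c₁ : ℝ)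
    (A : Fin m → Fin n → ℝ) (v : Fin m → ℝ) : ℝ≥0∞ :=
  ⨅ x ∈ feasibleSet n c₂ c₁, ENNReal.ofReal (maxUnit (Matrix.of A *ᵥ (xSol n - x) + σ • v))

/-- `(1/√n) 𝔼 min_x max_{‖l‖₂ = 1} lᵀ [A v] [x_sol - x; σ]`, where `A` is `m × n` and the entries
of `A` and `v` are i.i.d. standard normal. -/
noncomputable def xiPrimalN (m n : ℕ) (σ c₂ c₁ : ℝ) : ℝ≥0∞ :=
  ENNReal.ofReal (1 / √(n : ℝ)) *
    ∫⁻ p : (Fin m → Fin n → ℝ) × (Fin m → ℝ), minMaxResidual σ c₂ c₁ p.1 p.2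
      ∂((gaussMatrix m n).prod (gaussVector m))

/-- The asymptotic normalized expected value `ξ_p`, with `m n` rows in dimension `n`. The lower
limit always exists and equals the limit whenever there is one. -/
noncomputable def xiPrimal (m : ℕ → ℕ) (σ c₂ c₁ : ℝ) : ℝ≥0∞ :=
  liminf (fun n => xiPrimalN (m n) n σ c₂ c₁) atTop

theorem xiPrimal_eq_of_tendsto {m : ℕ → ℕ} {σ c₂ c₁ : ℝ} {ξ : ℝ≥0∞}
    (h : Tendsto (fun n => xiPrimalN (m n) n σ c₂ c₁) atTop (𝓝 ξ)) :
    xiPrimal m σ c₂ c₁ = ξ :=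
  h.liminf_eq

/-- The error function. -/
noncomputable def erf (x : ℝ) : ℝ := 2 / √Real.pi * ∫ t in (0 : ℝ)..x, Real.exp (-t ^ 2)

/-- The complementary error function. -/
noncomputable def erfc (x : ℝ) : ℝ := 1 - erf x

noncomputable def I22 (γ ν : ℝ) : ℝ :=
  1 / 2 * (ν + γ) * erfc ((ν + 2 * γ) / √2)
    - Real.exp (-(1 / 2) * (ν + 2 * γ) ^ 2) / √(2 * Real.pi)

/-- At `γ = 0` the division convention gives the value `0`, which is also the limit as `γ → 0`. -/
noncomputable def I1 (γ ν : ℝ) : ℝ :=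
  (√(Real.pi / 2) * (ν ^ 2 + 1) * erf ((2 * γ - ν) / √2)
    + √(Real.pi / 2) * (ν ^ 2 + 1) * erf ((2 * γ + ν) / √2)
    + Real.exp (-(1 / 2) * (ν + 2 * γ) ^ 2) * (ν - 2 * γ)
    - Real.exp (-(1 / 2) * (ν - 2 * γ) ^ 2) * (ν + 2 * γ)) / (4 * √(2 * Real.pi) * γ)

noncomputable def I21 (γ ν : ℝ) : ℝ :=
  -(1 / 2) * (ν - γ) * (erf ((ν - 2 * γ) / √2) + 1)
    - Real.exp (-(1 / 2) * (ν - 2 * γ) ^ 2) / √(2 * Real.pi)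

/-- The random dual value `ξ_RD(α, σ; c₂, c₁, γ, ν)`. -/
noncomputable def xiRD (α σ c₂ c₁ γ ν : ℝ) : ℝ :=
  √α * √(1 - 2 * c₁ + c₂ + σ ^ 2) + I22 γ ν - I1 γ ν + I21 γ ν - ν * c₁ - γ * c₂

/-! On the feasible set the vector `z = (x - xSol, -σ)` has constant squared norm `r² = 1 - 2c₁ + c₂
+ σ²`, and up to sign the residual is a Gaussian matrix applied to `z`. Gordon's comparison
(`gordon_comparison`) therefore bounds `𝔼 min ‖Gz‖` below by `r 𝔼‖g‖ + 𝔼 min ⟨h, z⟩` with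
independent standard Gaussian vectors `g` and `h`. It is proved by interpolating between the two
Gaussian families: for a smooth surrogate of `min` of norms, `softMin`, the derivative along the
path is a Gibbs average of `(r² - ⟨z, z'⟩)(1 - ⟨g, g'⟩) ≥ 0`, where `g`, `g'` are now gradients of
the smoothed norm (`sum_softMin''_le`). The surrogate's error is bounded independently of scale, so
rescaling removes it.

The first term is asymptotically at least `r√m` (`sqrt_mul_le_integral_norm`). The second is a
linear minimum over a box under two equality constraints. Weak Lagrangian duality with multipliers
`ν√n` and `γ√n` splits it into scalar problems over `[-1, 1]`, each bounded below by `boxDual`,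
whose Gaussian mean is `I22 - I1 + I21` (`integral_boxDual`). Comparison is done for finite families
and reaches the whole feasible set through a dense sequence and monotone convergence. Dividing by
`√n` and letting `n → ∞` gives `xiRD` for each `γ`, `ν`. -/

/-- The standard Gaussian measure on `J → ℝ`. -/
noncomputable abbrev stdGaussPi (J : Type*) [Fintype J] : Measure (J → ℝ) :=
  Measure.pi fun _ : J => gaussianReal 0 1

/-! ### Gaussian integration by parts. -/

theorem hasDerivAt_gaussianPDFReal (x : ℝ) :
    HasDerivAt (gaussianPDFReal 0 1) (-(x * gaussianPDFReal 0 1 x)) x := by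
  have h : HasDerivAt (fun x : ℝ => (√(2 * Real.pi * (1 : NNReal)))⁻¹ *
      Real.exp (-(x - 0) ^ 2 / (2 * (1 : NNReal))))
      ((√(2 * Real.pi * (1 : NNReal)))⁻¹ * (Real.exp (-(x - 0) ^ 2 / (2 * (1 : NNReal))) *
        (-(2 * (x - 0)) / (2 * (1 : NNReal))))) x := by
    refine HasDerivAt.const_mul _ (HasDerivAt.exp ?_)
    have := ((((hasDerivAt_id x).sub_const 0).pow 2).neg).div_const (2 * ((1 : NNReal) : ℝ))
    simpa using this
  rw [gaussianPDFReal_def]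
  convert h using 1
  simp
  ring

theorem integrable_gaussianReal_iff {f : ℝ → ℝ} :
    Integrable f (gaussianReal 0 1) ↔ Integrable (fun x => f x * gaussianPDFReal 0 1 x) := by
  rw [gaussianReal_of_var_ne_zero _ one_ne_zero,
    integrable_withDensity_iff (measurable_gaussianPDF _ _) (by simp [gaussianPDF_lt_top])]
  simp [toReal_gaussianPDF]

theorem integral_gaussianReal_eq {f : ℝ → ℝ} :
    ∫ x, f x ∂(gaussianReal 0 1) = ∫ x, f x * gaussianPDFReal 0 1 x := by
  rw [integral_gaussianReal_eq_integral_smul one_ne_zero]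
  simp [mul_comm]

theorem integrable_id_gaussianReal : Integrable (fun x : ℝ => x) (gaussianReal 0 1) :=
  (memLp_id_gaussianReal' 1 (by simp)).integrable le_rfl

/-- Stein's identity. -/
theorem integral_id_mul_gaussianReal {f f' : ℝ → ℝ} {C C' : ℝ}
    (hf : ∀ x, HasDerivAt f (f' x) x) (hf' : Continuous f')
    (hC : ∀ x, |f x| ≤ C) (hC' : ∀ x, |f' x| ≤ C') :
    ∫ x, x * f x ∂(gaussianReal 0 1) = ∫ x, f' x ∂(gaussianReal 0 1) := by
  have hfc : Continuous f := continuous_iff_continuousAt.2 fun x => (hf x).continuousAt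
  have i1 : Integrable f (gaussianReal 0 1) :=
    Integrable.of_bound hfc.aestronglyMeasurable C (Eventually.of_forall hC)
  have i2 : Integrable f' (gaussianReal 0 1) :=
    Integrable.of_bound hf'.aestronglyMeasurable C' (Eventually.of_forall hC')
  have i3 : Integrable (fun x => x * f x) (gaussianReal 0 1) :=
    integrable_id_gaussianReal.mul_bdd hfc.aestronglyMeasurable (Eventually.of_forall hC)
  rw [integrable_gaussianReal_iff] at i1 i2 i3
  have := integral_mul_deriv_eq_deriv_mul_of_integrable (u := f) (v := gaussianPDFReal 0 1)
    (fun x _ => hf x) (fun x _ => hasDerivAt_gaussianPDFReal x)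
    (by convert i3.neg using 1; ext x; simp; ring) i2 i1
  rw [integral_gaussianReal_eq, integral_gaussianReal_eq, ← neg_inj, ← this, ← integral_neg]
  congr 1; ext x; ring

/-- Resampling one coordinate leaves a product law unchanged. This allows integrating over
coordinate `j` first with the others frozen, which reduces integration by parts to dimension one. -/
theorem measurePreserving_update {J : Type*} [Fintype J] [DecidableEq J] {X : J → Type*}
    [∀ i, MeasurableSpace (X i)] (μ : ∀ i, Measure (X i)) [∀ i, IsProbabilityMeasure (μ i)]
    (j : J) :
    MeasurePreserving (fun p : (∀ i, X i) × X j => Function.update p.1 j p.2)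
      ((Measure.pi μ).prod (μ j)) (Measure.pi μ) := by
  have hm : Measurable (fun p : (∀ i, X i) × X j => Function.update p.1 j p.2) :=
    measurable_update'
  refine ⟨hm, (Measure.pi_eq fun s hs => ?_).symm⟩
  rw [Measure.map_apply hm (MeasurableSet.univ_pi hs)]
  have : (fun p : (∀ i, X i) × X j => Function.update p.1 j p.2) ⁻¹' (Set.univ.pi s) =
      (Set.univ.pi (Function.update s j Set.univ)) ×ˢ s j := by
    ext p
    simp only [Set.mem_preimage, Set.mem_pi, Set.mem_univ, true_imp_iff, Set.mem_prod]
    constructor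
    · intro h
      refine ⟨fun i => ?_, by simpa using h j⟩
      by_cases hi : i = j
      · subst hi; simp
      · simpa [hi] using h i
    · rintro ⟨h, h'⟩ i
      by_cases hi : i = j
      · subst hi; simpa using h'
      · simpa [hi] using h i
  rw [this, Measure.prod_prod, Measure.pi_pi, ← Finset.mul_prod_erase _ _ (Finset.mem_univ j),
    ← Finset.mul_prod_erase (a := j) Finset.univ (fun i => μ i (s i)) (Finset.mem_univ j)]
  simp only [Function.update_self, measure_univ, one_mul]
  rw [mul_comm]
  congr 1
  refine Finset.prod_congr rfl fun i hi => ?_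
  rw [Function.update_of_ne (Finset.ne_of_mem_erase hi)]

theorem measurePreserving_eval_gauss {J : Type*} [Fintype J] (j : J) :
    MeasurePreserving (fun x : J → ℝ => x j) (stdGaussPi J) (gaussianReal 0 1) :=
  measurePreserving_eval _ j

theorem integrable_coord {J : Type*} [Fintype J] (j : J) :
    Integrable (fun x : J → ℝ => x j) (stdGaussPi J) :=
  (measurePreserving_eval_gauss j).integrable_comp_of_integrable integrable_id_gaussianReal

theorem integral_coord {J : Type*} [Fintype J] (j : J) :
    ∫ x : J → ℝ, x j ∂(stdGaussPi J) = 0 := by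
  have := (measurePreserving_eval_gauss j).map_eq
  rw [← integral_map (φ := fun x : J → ℝ => x j) (f := fun t => t)
    (measurable_pi_apply j).aemeasurable (by fun_prop), this, integral_id_gaussianReal]

/-- Gaussian integration by parts in one coordinate. -/
theorem integral_coord_mul {J : Type*} [Fintype J] [DecidableEq J] (j : J)
    {G D : (J → ℝ) → ℝ} {C C' : ℝ}
    (hG : ∀ x t, HasDerivAt (fun t => G (Function.update x j t)) (D (Function.update x j t)) t)
    (hGc : Continuous G) (hDc : Continuous D) (hC : ∀ x, |G x| ≤ C) (hC' : ∀ x, |D x| ≤ C') :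
    ∫ x, x j * G x ∂(stdGaussPi J) = ∫ x, D x ∂(stdGaussPi J) := by
  have mp := measurePreserving_update (fun _ : J => gaussianReal 0 1) j
  have iG : Integrable (fun x => x j * G x) (stdGaussPi J) :=
    (integrable_coord j).mul_bdd hGc.aestronglyMeasurable (Eventually.of_forall hC)
  have iD : Integrable D (stdGaussPi J) :=
    Integrable.of_bound hDc.aestronglyMeasurable C' (Eventually.of_forall hC')
  have e1 := integral_map (μ := (stdGaussPi J).prod (gaussianReal 0 1)) mp.measurable.aemeasurable
    (f := fun x => x j * G x) (by rw [mp.map_eq]; exact iG.aestronglyMeasurable)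
  have e2 := integral_map (μ := (stdGaussPi J).prod (gaussianReal 0 1)) mp.measurable.aemeasurable
    (f := D) (by rw [mp.map_eq]; exact iD.aestronglyMeasurable)
  rw [mp.map_eq] at e1 e2
  rw [e1, e2]
  refine (integral_prod _ (mp.integrable_comp_of_integrable iG)).trans <| Eq.trans ?_
    (integral_prod _ (mp.integrable_comp_of_integrable iD)).symm
  refine integral_congr_ae (Eventually.of_forall fun x => ?_)
  simp only [Function.comp, Function.update_self]
  exact integral_id_mul_gaussianReal (hG x) (by fun_prop) (fun t => hC _) (fun t => hC' _)

/-! ### Interpolation between Gaussian families. -/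

section Interpolation

variable {J : Type*} [Fintype J] {V : Type*} [NormedAddCommGroup V] [NormedSpace ℝ V]

theorem integrable_norm_sum_smul (a : J → V) :
    Integrable (fun x : J → ℝ => ‖∑ j, x j • a j‖) (stdGaussPi J) := by
  refine (integrable_finsetSum Finset.univ (f := fun j (x : J → ℝ) => |x j| * ‖a j‖)
    fun j _ => (integrable_coord j).abs.mul_const _).mono'
    (Continuous.aestronglyMeasurable (by fun_prop)) (Eventually.of_forall fun x => ?_)
  rw [norm_norm]
  exact (norm_sum_le _ _).trans (Finset.sum_le_sum fun j _ => by rw [norm_smul, Real.norm_eq_abs])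

theorem integrable_lipschitz_comp {F : V → ℝ} {C : ℝ} (hFc : Continuous F)
    (hF : ∀ u, |F u - F 0| ≤ C * ‖u‖) (a : J → V) :
    Integrable (fun x : J → ℝ => F (∑ j, x j • a j)) (stdGaussPi J) := by
  refine (((integrable_norm_sum_smul a).const_mul C).add (integrable_const |F 0|)).mono'
    (Continuous.aestronglyMeasurable (by fun_prop)) (Eventually.of_forall fun x => ?_)
  have h1 := hF (∑ j, x j • a j)
  have h2 := abs_sub_abs_le_abs_sub (F (∑ j, x j • a j)) (F 0)
  simp only [Pi.add_apply, Real.norm_eq_abs]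
  linarith

theorem abs_sub_le_of_hasFDerivAt {F : V → ℝ} {F' : V → V →L[ℝ] ℝ} {C : ℝ}
    (hF : ∀ u, HasFDerivAt F (F' u) u) (hC : ∀ u, ‖F' u‖ ≤ C) (u : V) :
    |F u - F 0| ≤ C * ‖u‖ := by
  have := Convex.norm_image_sub_le_of_norm_hasFDerivWithin_le (s := Set.univ) (f := F) (f' := F')
    (C := C) (fun x _ => (hF x).hasFDerivWithinAt) (fun x _ => hC x) convex_univ
    (Set.mem_univ 0) (Set.mem_univ u)
  simpa using this

variable [DecidableEq J]

/-- The derivative of a Gaussian expectation along a path of covariances. -/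
theorem hasDerivAt_integral_interpolation {F : V → ℝ} {F' : V → V →L[ℝ] ℝ} {F'' : V → V → ℝ}
    {C : ℝ} {C₂ : V → ℝ} (hF : ∀ u, HasFDerivAt F (F' u) u) (hF'c : Continuous F')
    (hC : ∀ u, ‖F' u‖ ≤ C)
    (hF' : ∀ u a, HasDerivAt (fun t : ℝ => F' (u + t • a) a) (F'' u a) 0)
    (hF''c : ∀ a, Continuous fun u => F'' u a) (hC₂ : ∀ u a, |F'' u a| ≤ C₂ a)
    {c c' : ℝ → J → ℝ} (hc : ∀ θ j, HasDerivAt (fun θ => c θ j) (c' θ j) θ)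
    (hc' : ∀ θ j, |c' θ j| ≤ 1) (a : J → V) (θ : ℝ) :
    HasDerivAt (fun θ => ∫ x : J → ℝ, F (∑ j, x j • c θ j • a j) ∂(stdGaussPi J))
      (∑ j, c θ j * c' θ j * ∫ x : J → ℝ, F'' (∑ i, x i • c θ i • a i) (a j) ∂(stdGaussPi J)) θ := by
  have hFc : Continuous F := continuous_iff_continuousAt.2 fun u => (hF u).continuousAt
  have hCn : 0 ≤ C := (norm_nonneg _).trans (hC 0)
  -- Moving the coordinate `x j` moves the argument of `F'` along `c θ j • a j`. Integration by
  -- parts thus trades the factor `x j` for `c θ j` times a second derivative.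
  have ibp (j : J) : ∫ x : J → ℝ, x j * F' (∑ i, x i • c θ i • a i) (a j) ∂(stdGaussPi J) =
      ∫ x : J → ℝ, c θ j * F'' (∑ i, x i • c θ i • a i) (a j) ∂(stdGaussPi J) := by
    refine integral_coord_mul j (C := C * ‖a j‖) (C' := |c θ j| * C₂ (a j)) (fun x t => ?_)
      (by fun_prop) ?_ (fun x => ?_) (fun x => ?_)
    · set u := ∑ i, (Function.update x j t) i • c θ i • a i
      have e (s : ℝ) : ∑ i, (Function.update x j s) i • c θ i • a i =
          u + ((s - t) * c θ j) • a j := by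
        simp only [u]
        rw [← Finset.add_sum_erase _ _ (Finset.mem_univ j),
          ← Finset.add_sum_erase (a := j) _ (fun i => Function.update x j t i • c θ i • a i)
            (Finset.mem_univ j)]
        have : ∀ s, ∑ i ∈ Finset.univ.erase j, Function.update x j s i • c θ i • a i =
            ∑ i ∈ Finset.univ.erase j, x i • c θ i • a i := fun s =>
          Finset.sum_congr rfl fun i hi => by rw [Function.update_of_ne (Finset.ne_of_mem_erase hi)]
        rw [this, this]
        simp only [Function.update_self]
        module
      simp only [e]
      have h1 : HasDerivAt (fun s : ℝ => (s - t) * c θ j) (c θ j) t := by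
        simpa using ((hasDerivAt_id t).sub_const t).mul_const (c θ j)
      have h2 := HasDerivAt.scomp_of_eq (h := fun s : ℝ => (s - t) * c θ j) t (hF' u (a j)) h1
        (by simp)
      simpa [Function.comp_def] using h2
    · have := hF''c (a j)
      fun_prop
    · exact ((F' _).le_opNorm _).trans (by gcongr; exact hC _)
    · rw [abs_mul]
      gcongr
      exact hC₂ _ _
  -- Since `|c'| ≤ 1`, this bound on the `θ`-derivative does not depend on `θ`, as domination
  -- requires.
  have hb : Integrable (fun x : J → ℝ => C * ∑ j, |x j| * ‖a j‖) (stdGaussPi J) :=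
    (integrable_finsetSum _ fun j _ => (integrable_coord j).abs.mul_const _).const_mul _
  have key := hasDerivAt_integral_of_dominated_loc_of_deriv_le (μ := stdGaussPi J)
    (F := fun θ (x : J → ℝ) => F (∑ j, x j • c θ j • a j))
    (F' := fun θ (x : J → ℝ) => F' (∑ j, x j • c θ j • a j) (∑ j, x j • c' θ j • a j))
    (x₀ := θ) (s := Set.univ) (bound := fun x => C * ∑ j, |x j| * ‖a j‖) Filter.univ_mem
    (Eventually.of_forall fun θ => Continuous.aestronglyMeasurable (by fun_prop))
    (integrable_lipschitz_comp hFc (abs_sub_le_of_hasFDerivAt hF hC) _)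
    (Continuous.aestronglyMeasurable (by fun_prop))
    (Eventually.of_forall fun x θ _ => ?_) hb (Eventually.of_forall fun x θ _ => ?_)
  · refine key.2.congr_deriv ?_
    simp only [map_sum, map_smul, smul_eq_mul]
    symm
    rw [integral_finsetSum]
    · refine Finset.sum_congr rfl fun j _ => ?_
      rw [mul_comm (c θ j), mul_assoc, ← integral_const_mul, ← ibp, ← integral_const_mul]
      congr 1; ext x; ring
    · intro j _
      refine (integrable_coord j).mul_bdd (c := |c' θ j| * (C * ‖a j‖))
        (Continuous.aestronglyMeasurable (by fun_prop)) (Eventually.of_forall fun x => ?_)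
      rw [norm_mul, Real.norm_eq_abs]
      gcongr
      exact ((F' _).le_opNorm _).trans (by gcongr; exact hC _)
  · refine ((F' _).le_opNorm _).trans ?_
    gcongr
    · exact hC _
    · refine (norm_sum_le _ _).trans (Finset.sum_le_sum fun j _ => ?_)
      rw [norm_smul, norm_smul, Real.norm_eq_abs, Real.norm_eq_abs]
      gcongr
      exact mul_le_of_le_one_left (norm_nonneg _) (hc' θ j)
  · refine (hF _).comp_hasDerivAt θ (HasDerivAt.fun_sum fun j _ => ?_)
    exact ((hc θ j).smul_const (a j)).const_smul (x j)

end Interpolation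

/-- Comparison of Gaussian expectations from a comparison of traces of second derivatives. -/
theorem integral_le_integral_of_trace_le {J₁ J₂ : Type*} [Fintype J₁] [Fintype J₂] [DecidableEq J₁]
    [DecidableEq J₂] {V : Type*} [NormedAddCommGroup V] [NormedSpace ℝ V]
    {F : V → ℝ} {F' : V → V →L[ℝ] ℝ} {F'' : V → V → ℝ}
    {C : ℝ} {C₂ : V → ℝ} (hF : ∀ u, HasFDerivAt F (F' u) u) (hF'c : Continuous F')
    (hC : ∀ u, ‖F' u‖ ≤ C)
    (hF' : ∀ u a, HasDerivAt (fun t : ℝ => F' (u + t • a) a) (F'' u a) 0)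
    (hF''c : ∀ a, Continuous fun u => F'' u a) (hC₂ : ∀ u a, |F'' u a| ≤ C₂ a)
    (a : J₁ → V) (b : J₂ → V) (hab : ∀ u, ∑ j, F'' u (b j) ≤ ∑ j, F'' u (a j)) :
    ∫ x : J₂ → ℝ, F (∑ j, x j • b j) ∂(stdGaussPi J₂) ≤
      ∫ x : J₁ → ℝ, F (∑ j, x j • a j) ∂(stdGaussPi J₁) := by
  have hFc : Continuous F := continuous_iff_continuousAt.2 fun u => (hF u).continuousAt
  -- A rotation path: only the `b` family is present at `θ = 0` and only the `a` family at `θ = π /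
  -- 2`. The products `c c'` are `sin θ cos θ` and its negative, so the derivative is `sin θ cos θ`
  -- times the expected trace difference.
  let c : ℝ → J₁ ⊕ J₂ → ℝ := fun θ => Sum.elim (fun _ => Real.sin θ) fun _ => Real.cos θ
  let c' : ℝ → J₁ ⊕ J₂ → ℝ := fun θ => Sum.elim (fun _ => Real.cos θ) fun _ => -Real.sin θ
  have hd := hasDerivAt_integral_interpolation hF hF'c hC hF' hF''c hC₂ (c := c) (c' := c')
    (by rintro θ (j | j)
        · exact Real.hasDerivAt_sin θ
        · exact Real.hasDerivAt_cos θ)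
    (by rintro θ (j | j)
        · exact Real.abs_cos_le_one θ
        · simpa [c'] using Real.abs_sin_le_one θ) (Sum.elim a b)
  set φ : ℝ → ℝ := fun θ => ∫ x : J₁ ⊕ J₂ → ℝ, F (∑ j, x j • c θ j • Sum.elim a b j)
    ∂(stdGaussPi (J₁ ⊕ J₂))
  have hmono : MonotoneOn φ (Set.Icc 0 (Real.pi / 2)) := by
    refine monotoneOn_of_deriv_nonneg (convex_Icc _ _)
      (fun θ _ => (hd θ).continuousAt.continuousWithinAt)
      (fun θ _ => (hd θ).differentiableAt.differentiableWithinAt) fun θ hθ => ?_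
    rw [interior_Icc] at hθ
    rw [(hd θ).deriv]
    simp only [Fintype.sum_sum_type, Sum.elim_inl, Sum.elim_inr, c, c']
    have i (v : V) : Integrable (fun x : J₁ ⊕ J₂ → ℝ => F'' (∑ i, x i •
        c θ i • (Sum.elim a b i)) v) (stdGaussPi (J₁ ⊕ J₂)) := by
      have := hF''c v
      exact Integrable.of_bound (Continuous.aestronglyMeasurable (by fun_prop)) (C₂ v)
        (Eventually.of_forall fun x => hC₂ _ _)
    have hs : 0 ≤ Real.sin θ := Real.sin_nonneg_of_nonneg_of_le_pi hθ.1.le (by linarith [hθ.2, hθ.1])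
    have hcs : 0 ≤ Real.cos θ := Real.cos_nonneg_of_neg_pi_div_two_le_of_le (by linarith [hθ.2, hθ.1]) hθ.2.le
    rw [← Finset.mul_sum, ← Finset.mul_sum]
    have h : ∑ j, ∫ x : J₁ ⊕ J₂ → ℝ, F'' (∑ i, x i • c θ i • (Sum.elim a b i)) (b j)
        ∂(stdGaussPi (J₁ ⊕ J₂)) ≤
        ∑ j, ∫ x : J₁ ⊕ J₂ → ℝ, F'' (∑ i, x i • c θ i • (Sum.elim a b i)) (a j)
        ∂(stdGaussPi (J₁ ⊕ J₂)) := by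
      rw [← integral_finsetSum _ fun j _ => i (b j), ← integral_finsetSum _ fun j _ => i (a j)]
      exact integral_mono (integrable_finsetSum _ fun j _ => i (b j))
        (integrable_finsetSum _ fun j _ => i (a j)) fun x => hab _
    have h2 := mul_le_mul_of_nonneg_left h (mul_nonneg hs hcs)
    simp only [Fintype.sum_sum_type, Sum.elim_inl, Sum.elim_inr, c] at h2
    linarith
  have hpi := Real.pi_pos
  have h0 := hmono (Set.left_mem_Icc.2 (by positivity)) (Set.right_mem_Icc.2 (by positivity))
    (by positivity)
  have mp := measurePreserving_sumPiEquivProdPi (fun _ : J₁ ⊕ J₂ => gaussianReal 0 1)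
  have mp1 : MeasurePreserving (fun (x : J₁ ⊕ J₂ → ℝ) i => x (Sum.inl i))
      (stdGaussPi (J₁ ⊕ J₂)) (stdGaussPi J₁) := measurePreserving_fst.comp mp
  have mp2 : MeasurePreserving (fun (x : J₁ ⊕ J₂ → ℝ) i => x (Sum.inr i))
      (stdGaussPi (J₁ ⊕ J₂)) (stdGaussPi J₂) := measurePreserving_snd.comp mp
  have hl : φ 0 = ∫ x : J₂ → ℝ, F (∑ j, x j • b j) ∂(stdGaussPi J₂) := by
    rw [← mp2.map_eq, integral_map mp2.measurable.aemeasurable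
      (Continuous.aestronglyMeasurable (by fun_prop))]
    simp [φ, c]
  have hr : φ (Real.pi / 2) = ∫ x : J₁ → ℝ, F (∑ j, x j • a j) ∂(stdGaussPi J₁) := by
    rw [← mp1.map_eq, integral_map mp1.measurable.aemeasurable
      (Continuous.aestronglyMeasurable (by fun_prop))]
    simp [φ, c]
  rwa [hl, hr] at h0

/-! ### A smooth surrogate for a minimum of norms plus scalars. -/

section SoftMin

variable {E : Type*} [NormedAddCommGroup E]

/-- A smooth approximation of the norm. -/
noncomputable def smoothNorm (w : E) : ℝ := √(1 + ‖w‖ ^ 2)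

theorem smoothNorm_pos (w : E) : 0 < smoothNorm w := Real.sqrt_pos.2 (by positivity)

theorem one_le_smoothNorm (w : E) : 1 ≤ smoothNorm w := Real.one_le_sqrt.2 (by nlinarith [sq_nonneg ‖w‖])

theorem norm_le_smoothNorm (w : E) : ‖w‖ ≤ smoothNorm w :=
  Real.le_sqrt_of_sq_le (by linarith)

theorem smoothNorm_le (w : E) : smoothNorm w ≤ ‖w‖ + 1 := by
  refine (Real.sqrt_le_left (by positivity)).2 ?_
  nlinarith [norm_nonneg w]

theorem continuous_smoothNorm : Continuous (smoothNorm (E := E)) := by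
  unfold smoothNorm; fun_prop

variable [InnerProductSpace ℝ E]

theorem hasFDerivAt_smoothNorm (w : E) :
    HasFDerivAt smoothNorm ((smoothNorm w)⁻¹ • innerSL ℝ w) w := by
  have h := ((hasStrictFDerivAt_norm_sq w).hasFDerivAt.const_add 1).sqrt (by positivity)
  refine h.congr_fderiv ?_
  ext v
  simp [smoothNorm]
  ring

/-- The gradient of `smoothNorm`. -/
noncomputable def smoothGrad (w : E) : E := (smoothNorm w)⁻¹ • w

theorem norm_smoothGrad_le (w : E) : ‖smoothGrad w‖ ≤ 1 := by
  rw [smoothGrad, norm_smul, norm_inv, Real.norm_eq_abs, abs_of_pos (smoothNorm_pos w),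
    inv_mul_le_iff₀ (smoothNorm_pos w), mul_one]
  exact norm_le_smoothNorm w

theorem continuous_smoothGrad : Continuous (smoothGrad (E := E)) := by
  have := continuous_smoothNorm (E := E)
  exact (this.inv₀ fun w => (smoothNorm_pos w).ne').smul continuous_id

/-- The second derivative of `smoothNorm` in the direction `b`. -/
noncomputable def smoothHess (w b : E) : ℝ :=
  (‖b‖ ^ 2 - inner ℝ (smoothGrad w) b ^ 2) / smoothNorm w

theorem continuous_smoothHess (b : E) : Continuous fun w : E => smoothHess w b := by
  have h1 := continuous_smoothNorm (E := E)
  have h2 := continuous_smoothGrad (E := E)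
  exact Continuous.div (by fun_prop) h1 fun w => (smoothNorm_pos w).ne'

theorem smoothHess_smul (w : E) (c : ℝ) (b : E) : smoothHess w (c • b) = c ^ 2 * smoothHess w b := by
  simp only [smoothHess, norm_smul, inner_smul_right, mul_pow, Real.norm_eq_abs, sq_abs]
  ring

theorem abs_smoothHess_le (w b : E) : |smoothHess w b| ≤ ‖b‖ ^ 2 := by
  have h := abs_real_inner_le_norm (smoothGrad w) b
  have h' : |inner ℝ (smoothGrad w) b| ≤ ‖b‖ :=
    h.trans (mul_le_of_le_one_left (norm_nonneg _) (norm_smoothGrad_le w))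
  have h2 := sq_le_sq' (by linarith [abs_nonneg (inner ℝ (smoothGrad w) b), norm_nonneg b]) h'
  rw [sq_abs] at h2
  rw [smoothHess, abs_div, abs_of_pos (smoothNorm_pos w), abs_of_nonneg (by linarith)]
  exact (div_le_self (by linarith) (one_le_smoothNorm w)).trans (by nlinarith [sq_nonneg (inner ℝ (smoothGrad w) b)])

theorem hasDerivAt_inner_smoothGrad (w b : E) :
    HasDerivAt (fun t : ℝ => inner ℝ (smoothGrad (w + t • b)) b) (smoothHess w b) 0 := by
  have hl : HasDerivAt (fun t : ℝ => w + t • b) b 0 := by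
    simpa using ((hasDerivAt_id (0 : ℝ)).smul_const b).const_add w
  have h1 : HasDerivAt (fun t : ℝ => smoothNorm (w + t • b)) (inner ℝ (smoothGrad w) b) 0 := by
    have := (hasFDerivAt_smoothNorm (w + (0 : ℝ) • b)).comp_hasDerivAt 0 hl
    simpa [smoothGrad, inner_smul_left, Function.comp_def] using this
  have h2 : HasDerivAt (fun t : ℝ => inner ℝ (w + t • b) b) (‖b‖ ^ 2) 0 := by
    simpa using hl.inner ℝ (hasDerivAt_const (0 : ℝ) b)
  have h3 := h2.div h1 (smoothNorm_pos _).ne'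
  have hp := smoothNorm_pos w
  refine (h3.congr_deriv ?_).congr_of_eventuallyEq (Eventually.of_forall fun t => ?_)
  · simp only [zero_smul, add_zero, smoothHess, smoothGrad, inner_smul_left]
    simp
    field_simp
  · simp only [smoothGrad, real_inner_smul_left, Pi.div_apply, div_eq_inv_mul]

/-- The smoothed objective `‖w‖ + s`. -/
noncomputable def softTerm (y : E × ℝ) : ℝ := smoothNorm y.1 + y.2

noncomputable def softTerm' (y : E × ℝ) : E × ℝ →L[ℝ] ℝ :=
  (innerSL ℝ (smoothGrad y.1)).comp (ContinuousLinearMap.fst ℝ E ℝ) + ContinuousLinearMap.snd ℝ E ℝ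

theorem softTerm'_apply (y b : E × ℝ) : softTerm' y b = inner ℝ (smoothGrad y.1) b.1 + b.2 := by
  simp [softTerm']

theorem hasFDerivAt_softTerm (y : E × ℝ) : HasFDerivAt softTerm (softTerm' y) y := by
  have h := ((hasFDerivAt_smoothNorm y.1).comp y (hasFDerivAt_fst (p := y))).add (hasFDerivAt_snd (p := y))
  refine h.congr_fderiv ?_
  ext v <;> simp [softTerm', smoothGrad]

theorem continuous_softTerm : Continuous (softTerm (E := E)) :=
  continuous_iff_continuousAt.2 fun u => (hasFDerivAt_softTerm u).continuousAt

theorem continuous_softTerm' : Continuous (softTerm' (E := E)) := by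
  have := continuous_smoothGrad (E := E)
  unfold softTerm'
  fun_prop

theorem abs_softTerm'_apply_le (y b : E × ℝ) : |softTerm' y b| ≤ 2 * ‖b‖ := by
  rw [softTerm'_apply]
  have h := abs_real_inner_le_norm (smoothGrad y.1) b.1
  have h' : |inner ℝ (smoothGrad y.1) b.1| ≤ ‖b.1‖ :=
    h.trans (mul_le_of_le_one_left (norm_nonneg _) (norm_smoothGrad_le y.1))
  have h1 := norm_fst_le b
  have h2 := norm_snd_le b
  rw [Real.norm_eq_abs] at h2
  exact (abs_add_le _ _).trans (by linarith)

theorem hasDerivAt_softTerm' (y b : E × ℝ) :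
    HasDerivAt (fun t : ℝ => softTerm' (y + t • b) b) (smoothHess y.1 b.1) 0 := by
  simp only [softTerm'_apply]
  exact (hasDerivAt_inner_smoothGrad y.1 b.1).add_const b.2

variable {ι : Type*} [Fintype ι]

/-- A smooth approximation of `min_i (‖wᵢ‖ + sᵢ)`. -/
noncomputable def softMin (u : ι → E × ℝ) : ℝ := -Real.log (∑ i, Real.exp (-softTerm (u i)))

/-- The Gibbs weights of `softMin`. -/
noncomputable def gibbs (u : ι → E × ℝ) (i : ι) : ℝ := Real.exp (softMin u - softTerm (u i))

set_option linter.unusedSectionVars false in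
theorem gibbs_pos (u : ι → E × ℝ) (i : ι) : 0 < gibbs u i := Real.exp_pos _

noncomputable def softMin' (u : ι → E × ℝ) : (ι → E × ℝ) →L[ℝ] ℝ :=
  ∑ i, gibbs u i • (softTerm' (u i)).comp (ContinuousLinearMap.proj i)

theorem softMin'_apply (u a : ι → E × ℝ) :
    softMin' u a = ∑ i, gibbs u i * softTerm' (u i) (a i) := by
  simp [softMin']

/-- The second derivative of `softMin` in the direction `a`. -/
noncomputable def softMin'' (u a : ι → E × ℝ) : ℝ :=
  ∑ i, gibbs u i * (smoothHess (u i).1 (a i).1 - softTerm' (u i) (a i) ^ 2) + softMin' u a ^ 2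

variable [Nonempty ι]

set_option linter.unusedSectionVars false in
theorem exp_neg_softMin (u : ι → E × ℝ) :
    Real.exp (-softMin u) = ∑ i, Real.exp (-softTerm (u i)) := by
  rw [softMin, neg_neg, Real.exp_log]
  exact Finset.sum_pos (fun i _ => Real.exp_pos _) Finset.univ_nonempty

theorem sum_gibbs (u : ι → E × ℝ) : ∑ i, gibbs u i = 1 := by
  simp only [gibbs, sub_eq_add_neg, Real.exp_add]
  rw [← Finset.mul_sum, ← exp_neg_softMin, ← Real.exp_add]
  simp

theorem hasFDerivAt_softMin (u : ι → E × ℝ) : HasFDerivAt softMin (softMin' u) u := by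
  have h1 (i : ι) : HasFDerivAt (fun u : ι → E × ℝ => Real.exp (-softTerm (u i)))
      (Real.exp (-softTerm (u i)) • -((softTerm' (u i)).comp (ContinuousLinearMap.proj i))) u :=
    (HasFDerivAt.comp (g := softTerm) (f := fun u : ι → E × ℝ => u i) u
      (hasFDerivAt_softTerm (u i)) (hasFDerivAt_apply i u)).neg.exp
  have hs := exp_neg_softMin u
  have h2 := ((HasFDerivAt.fun_sum (u := Finset.univ) fun i _ => h1 i).log
    (by rw [← hs]; exact (Real.exp_pos _).ne')).neg
  refine h2.congr_fderiv ?_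
  rw [← hs, ← Real.exp_neg, neg_neg, softMin', Finset.smul_sum, ← Finset.sum_neg_distrib]
  refine Finset.sum_congr rfl fun i _ => ?_
  rw [gibbs, sub_eq_add_neg, Real.exp_add, smul_smul, smul_neg, neg_neg]

theorem continuous_softMin : Continuous (softMin (ι := ι) (E := E)) :=
  continuous_iff_continuousAt.2 fun u => (hasFDerivAt_softMin u).continuousAt

theorem continuous_gibbs (i : ι) : Continuous fun u : ι → E × ℝ => gibbs u i := by
  have h1 := continuous_softMin (ι := ι) (E := E)
  have h2 := continuous_softTerm (E := E)
  unfold gibbs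
  fun_prop

theorem continuous_softMin' : Continuous (softMin' (ι := ι) (E := E)) := by
  have h1 := continuous_gibbs (ι := ι) (E := E)
  have h2 := continuous_softTerm' (E := E)
  unfold softMin'
  refine continuous_finsetSum _ fun i _ => (h1 i).smul ?_
  exact (h2.comp (continuous_apply i)).clm_comp continuous_const

theorem continuous_softMin'' (a : ι → E × ℝ) : Continuous fun u => softMin'' u a := by
  have h1 := continuous_gibbs (ι := ι) (E := E)
  have h2 := continuous_softTerm' (E := E)
  have h3 := continuous_softMin' (ι := ι) (E := E)
  unfold softMin''
  refine Continuous.add (continuous_finsetSum _ fun i _ => (h1 i).mul (Continuous.sub ?_ ?_)) ?_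
  · exact (continuous_smoothHess (a i).1).comp (by fun_prop)
  · fun_prop
  · fun_prop

theorem abs_softMin'_apply_le (u a : ι → E × ℝ) : |softMin' u a| ≤ 2 * ‖a‖ := by
  rw [softMin'_apply]
  calc _ ≤ ∑ i, |gibbs u i * softTerm' (u i) (a i)| := Finset.abs_sum_le_sum_abs _ _
    _ ≤ ∑ i, gibbs u i * (2 * ‖a‖) := Finset.sum_le_sum fun i _ => by
        rw [abs_mul, abs_of_pos (gibbs_pos u i)]
        have := norm_le_pi_norm a i
        gcongr
        · exact (gibbs_pos u i).le
        · exact (abs_softTerm'_apply_le _ _).trans (by linarith)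
    _ = 2 * ‖a‖ := by rw [← Finset.sum_mul, sum_gibbs, one_mul]

theorem norm_softMin'_le (u : ι → E × ℝ) : ‖softMin' u‖ ≤ 2 :=
  ContinuousLinearMap.opNorm_le_bound _ (by norm_num) fun a => abs_softMin'_apply_le u a

/-- Only uniformity in `u` matters. The constant is `1` from `smoothHess`, `4` from the square of a
`softTerm'` bounded by `2‖a‖`, and `4` from the square of `softMin'`. -/
theorem abs_softMin''_le (u a : ι → E × ℝ) : |softMin'' u a| ≤ 9 * ‖a‖ ^ 2 := by
  have sq {x y : ℝ} (h : |x| ≤ 2 * y) : x ^ 2 ≤ 4 * y ^ 2 := by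
    rw [← sq_abs]; nlinarith [abs_nonneg x]
  have h1 := sq (abs_softMin'_apply_le u a)
  have h2 : |∑ i, gibbs u i * (smoothHess (u i).1 (a i).1 - softTerm' (u i) (a i) ^ 2)| ≤
      5 * ‖a‖ ^ 2 :=
    calc _ ≤ ∑ i, |gibbs u i * (smoothHess (u i).1 (a i).1 - softTerm' (u i) (a i) ^ 2)| :=
          Finset.abs_sum_le_sum_abs _ _
      _ ≤ ∑ i, gibbs u i * (5 * ‖a‖ ^ 2) := Finset.sum_le_sum fun i _ => by
        rw [abs_mul, abs_of_pos (gibbs_pos u i)]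
        have h3 := norm_le_pi_norm a i
        have h4 := norm_fst_le (a i)
        have h5 := sq (abs_softTerm'_apply_le (u i) (a i))
        have h6 := abs_smoothHess_le (u i).1 (a i).1
        have h7 : ‖a i‖ ^ 2 ≤ ‖a‖ ^ 2 := by gcongr
        have h8 : ‖(a i).1‖ ^ 2 ≤ ‖a‖ ^ 2 := pow_le_pow_left₀ (norm_nonneg _) (h4.trans h3) 2
        have := (gibbs_pos u i).le
        gcongr
        refine (abs_sub _ _).trans ?_
        rw [abs_of_nonneg (sq_nonneg (softTerm' (u i) (a i)))]
        linarith
      _ = 5 * ‖a‖ ^ 2 := by rw [← Finset.sum_mul, sum_gibbs, one_mul]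
  rw [softMin'']
  refine (abs_add_le _ _).trans ?_
  rw [abs_of_nonneg (sq_nonneg (softMin' u a))]
  linarith

/-- Each Gibbs weight has logarithmic derivative `softMin' - softTerm'`, so differentiating the
weighted average of `softTerm'` produces minus the Gibbs variance of `softTerm'` besides the
averaged Hessian. -/
theorem hasDerivAt_softMin' (u a : ι → E × ℝ) :
    HasDerivAt (fun t : ℝ => softMin' (u + t • a) a) (softMin'' u a) 0 := by
  have hl : HasDerivAt (fun t : ℝ => u + t • a) a 0 := by
    simpa using ((hasDerivAt_id (0 : ℝ)).smul_const a).const_add u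
  have hli (i : ι) : HasDerivAt (fun t : ℝ => u i + t • a i) (a i) 0 := by
    simpa using ((hasDerivAt_id (0 : ℝ)).smul_const (a i)).const_add (u i)
  have h1 : HasDerivAt (fun t : ℝ => softMin (u + t • a)) (softMin' u a) 0 := by
    simpa [Function.comp_def] using (hasFDerivAt_softMin (u + (0 : ℝ) • a)).comp_hasDerivAt 0 hl
  have h2 (i : ι) : HasDerivAt (fun t : ℝ => softTerm (u i + t • a i)) (softTerm' (u i) (a i)) 0 := by
    simpa [Function.comp_def] using (hasFDerivAt_softTerm (u i + (0 : ℝ) • a i)).comp_hasDerivAt 0 (hli i)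
  have h3 (i : ι) : HasDerivAt (fun t : ℝ => gibbs (u + t • a) i)
      (gibbs u i * (softMin' u a - softTerm' (u i) (a i))) 0 := by
    simpa [gibbs] using (h1.sub (h2 i)).exp
  simp only [softMin'_apply]
  have h4 := HasDerivAt.fun_sum (u := Finset.univ) fun i (_ : i ∈ Finset.univ) =>
    (h3 i).mul (hasDerivAt_softTerm' (u i) (a i))
  refine h4.congr_deriv ?_
  simp only [zero_smul, add_zero, softMin'']
  rw [sq (softMin' u a)]
  nth_rw 3 [softMin'_apply]
  rw [Finset.mul_sum, ← Finset.sum_add_distrib]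
  exact Finset.sum_congr rfl fun i _ => by ring

/-- The loss `1` comes from smoothing the norm; the loss `log (card ι)` in `le_softMin` comes from
replacing the minimum by a log-sum. Neither depends on `u`, so both become negligible when `u` is
scaled up. -/
theorem softMin_le (u : ι → E × ℝ) : softMin u ≤ (⨅ i, (‖(u i).1‖ + (u i).2)) + 1 := by
  rw [← sub_le_iff_le_add]
  refine le_ciInf fun i => ?_
  have h : softMin u ≤ softTerm (u i) := by
    rw [← neg_le_neg_iff, ← Real.exp_le_exp, exp_neg_softMin]
    exact Finset.single_le_sum (f := fun i => Real.exp (-softTerm (u i)))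
      (fun i _ => (Real.exp_pos _).le) (Finset.mem_univ i)
  have := smoothNorm_le (u i).1
  rw [softTerm] at h
  linarith

theorem le_softMin (u : ι → E × ℝ) :
    (⨅ i, (‖(u i).1‖ + (u i).2)) - Real.log (Fintype.card ι) ≤ softMin u := by
  set b := ⨅ i, (‖(u i).1‖ + (u i).2)
  have hc : (0 : ℝ) < Fintype.card ι := by exact_mod_cast Fintype.card_pos
  rw [← neg_le_neg_iff, ← Real.exp_le_exp, exp_neg_softMin, neg_sub, sub_eq_add_neg, Real.exp_add,
    Real.exp_log hc, ← nsmul_eq_mul]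
  refine Finset.sum_le_card_nsmul _ _ _ fun i _ => Real.exp_le_exp.2 (neg_le_neg ?_)
  refine (ciInf_le (Set.finite_range _).bddBelow i).trans ?_
  rw [softTerm]
  linarith [norm_le_smoothNorm (u i).1]

end SoftMin

/-! ### Gordon's comparison inequality. -/

section Gordon

variable {E : Type*} [NormedAddCommGroup E] [InnerProductSpace ℝ E]
  {ι κ τ : Type*} [Fintype ι] [Fintype κ] [Fintype τ]

theorem sum_sq_sum_mul (p x : ι → ℝ) :
    (∑ i, p i * x i) ^ 2 = ∑ i, ∑ i', p i * p i' * (x i * x i') := by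
  rw [sq, Finset.sum_mul_sum]
  exact Finset.sum_congr rfl fun i _ => Finset.sum_congr rfl fun i' _ => by ring

variable [Nonempty ι]

theorem inner_eq_sum_basis (e : OrthonormalBasis τ ℝ E) (x y : E) :
    inner ℝ x y = ∑ j, inner ℝ x (e j) * inner ℝ y (e j) := by
  rw [← e.sum_inner_mul_inner x y]
  exact Finset.sum_congr rfl fun j _ => by rw [real_inner_comm y]

/-- With Gibbs weights `p` and smoothed gradients `g`, the right side minus the left is exactly `∑ p
i p i' (r² - ⟨z i, z i'⟩)(1 - ⟨g i, g i'⟩)`. Both factors are nonnegative because the `z i` share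
the norm `r` and `‖g i‖ ≤ 1`. No auxiliary scalar Gaussian is needed: a common shift of all terms
has zero second derivative. -/
theorem sum_softMin''_le (e : OrthonormalBasis τ ℝ E) {z : ι → κ → ℝ} {r : ℝ}
    (hz : ∀ i, z i ⬝ᵥ z i = r ^ 2) (u : ι → E × ℝ) :
    ∑ j : τ ⊕ κ, softMin'' u (Sum.elim (fun j _ => (r • e j, 0)) (fun k i => (0, z i k)) j) ≤
      ∑ jk : τ × κ, softMin'' u (fun i => (z i jk.2 • e jk.1, 0)) := by
  have hr (i : ι) : ∑ k, z i k ^ 2 = r ^ 2 := by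
    rw [← hz i]; simp only [dotProduct, sq]
  set g : ι → E := fun i => smoothGrad (u i).1
  set p := gibbs u
  have hg (i i') : inner ℝ (g i) (g i') ≤ 1 :=
    (real_inner_le_norm _ _).trans (mul_le_one₀ (norm_smoothGrad_le _) (norm_nonneg _) (norm_smoothGrad_le _))
  have hzz (i i') : z i ⬝ᵥ z i' ≤ r ^ 2 := by
    have h : 0 ≤ ∑ k, (z i k - z i' k) ^ 2 := Finset.sum_nonneg fun k _ => sq_nonneg _
    have h2 : ∑ k, (z i k - z i' k) ^ 2 = r ^ 2 + r ^ 2 - 2 * (z i ⬝ᵥ z i') := by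
      nth_rw 1 [← hr i]
      rw [← hr i', dotProduct, Finset.mul_sum, ← Finset.sum_add_distrib, ← Finset.sum_sub_distrib]
      exact Finset.sum_congr rfl fun k _ => by ring
    linarith
  -- The diagonal contribution. It enters both sides with the same factor `r²`, since every `z i`
  -- has squared norm `r²`, and cancels.
  set Λ : ℝ := ∑ j, ∑ i, p i * (smoothHess (u i).1 (e j) - inner ℝ (g i) (e j) ^ 2)
  have hX : ∑ jk : τ × κ, softMin'' u (fun i => (z i jk.2 • e jk.1, 0)) =
      r ^ 2 * Λ + ∑ i, ∑ i', p i * p i' * ((z i ⬝ᵥ z i') * inner ℝ (g i) (g i')) := by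
    have h1 (jk : τ × κ) : softMin'' u (fun i => (z i jk.2 • e jk.1, 0)) =
        ∑ i, p i * (z i jk.2 ^ 2 * (smoothHess (u i).1 (e jk.1) - inner ℝ (g i) (e jk.1) ^ 2)) +
        ∑ i, ∑ i', p i * p i' * ((z i jk.2 * z i' jk.2) *
          (inner ℝ (g i) (e jk.1) * inner ℝ (g i') (e jk.1))) := by
      simp only [softMin'', softMin'_apply, softTerm'_apply, smoothHess_smul, real_inner_smul_right,
        add_zero, sum_sq_sum_mul]
      congr 1
      · exact Finset.sum_congr rfl fun i _ => by simp only [p, g]; ring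
      · exact Finset.sum_congr rfl fun i _ => Finset.sum_congr rfl fun i' _ => by
          simp only [p, g]; ring
    simp only [h1]
    rw [Finset.sum_add_distrib]
    congr 1
    · rw [Fintype.sum_prod_type, Finset.mul_sum]
      refine Finset.sum_congr rfl fun j _ => ?_
      rw [Finset.sum_comm, Finset.mul_sum]
      refine Finset.sum_congr rfl fun i _ => ?_
      simp only
      rw [← Finset.mul_sum, ← Finset.sum_mul, hr]
      ring
    · rw [Finset.sum_comm]
      refine Finset.sum_congr rfl fun i _ => ?_
      rw [Finset.sum_comm]
      refine Finset.sum_congr rfl fun i' _ => ?_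
      rw [← Finset.mul_sum, inner_eq_sum_basis e, mul_comm (z i ⬝ᵥ z i'), dotProduct,
        Finset.sum_mul_sum, Fintype.sum_prod_type]
      congr 1
      exact Finset.sum_congr rfl fun j _ => Finset.sum_congr rfl fun k _ => by ring
  have hY1 : ∑ j : τ, softMin'' u (fun _ => (r • e j, 0)) =
      r ^ 2 * Λ + ∑ i, ∑ i', p i * p i' * (r ^ 2 * inner ℝ (g i) (g i')) := by
    have h1 (j : τ) : softMin'' u (fun _ => (r • e j, 0)) =
        r ^ 2 * ∑ i, p i * (smoothHess (u i).1 (e j) - inner ℝ (g i) (e j) ^ 2) +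
        ∑ i, ∑ i', p i * p i' * (r ^ 2 *
          (inner ℝ (g i) (e j) * inner ℝ (g i') (e j))) := by
      simp only [softMin'', softMin'_apply, softTerm'_apply, smoothHess_smul, real_inner_smul_right,
        add_zero, sum_sq_sum_mul, Finset.mul_sum]
      congr 1
      · exact Finset.sum_congr rfl fun i _ => by simp only [p, g]; ring
      · exact Finset.sum_congr rfl fun i _ => Finset.sum_congr rfl fun i' _ => by
          simp only [p, g]; ring
    simp only [h1]
    rw [Finset.sum_add_distrib, ← Finset.mul_sum]
    congr 1
    rw [Finset.sum_comm]
    refine Finset.sum_congr rfl fun i _ => ?_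
    rw [Finset.sum_comm]
    refine Finset.sum_congr rfl fun i' _ => ?_
    rw [← Finset.mul_sum, ← Finset.mul_sum, inner_eq_sum_basis e]
  have hp : ∑ i, p i = 1 := sum_gibbs u
  have hY2 : ∑ k : κ, softMin'' u (fun i => ((0 : E), z i k)) =
      -r ^ 2 + ∑ i, ∑ i', p i * p i' * (z i ⬝ᵥ z i') := by
    have h1 (k : κ) : softMin'' u (fun i => ((0 : E), z i k)) =
        ∑ i, p i * (- z i k ^ 2) + ∑ i, ∑ i', p i * p i' * (z i k * z i' k) := by
      simp only [softMin'', softMin'_apply, softTerm'_apply, smoothHess, inner_zero_right,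
        norm_zero, zero_add, sum_sq_sum_mul]
      simp [p]
    simp only [h1]
    rw [Finset.sum_add_distrib]
    congr 1
    · rw [Finset.sum_comm]
      simp only [← Finset.mul_sum, Finset.sum_neg_distrib, hr]
      rw [← Finset.sum_mul, hp, one_mul]
    · rw [Finset.sum_comm]
      refine Finset.sum_congr rfl fun i _ => ?_
      rw [Finset.sum_comm]
      refine Finset.sum_congr rfl fun i' _ => ?_
      rw [← Finset.mul_sum, dotProduct]
  -- Writing the constant as a double Gibbs average lets it join the product in `key`.
  have hpp : r ^ 2 = ∑ i, ∑ i', p i * p i' * r ^ 2 := by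
    simp only [← Finset.sum_mul, ← Finset.mul_sum, hp, one_mul]
  rw [Fintype.sum_sum_type]
  simp only [Sum.elim_inl, Sum.elim_inr]
  rw [hX, hY1, hY2]
  have key : 0 ≤ ∑ i, ∑ i', p i * p i' * ((r ^ 2 - z i ⬝ᵥ z i') * (1 - inner ℝ (g i) (g i'))) :=
    Finset.sum_nonneg fun i _ => Finset.sum_nonneg fun i' _ =>
      mul_nonneg (mul_nonneg (gibbs_pos u i).le (gibbs_pos u i').le)
        (mul_nonneg (sub_nonneg.2 (hzz i i')) (sub_nonneg.2 (hg i i')))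
  have expand : ∑ i, ∑ i', p i * p i' * ((r ^ 2 - z i ⬝ᵥ z i') * (1 - inner ℝ (g i) (g i'))) =
      ∑ i, ∑ i', p i * p i' * r ^ 2 - ∑ i, ∑ i', p i * p i' * (z i ⬝ᵥ z i') -
      ∑ i, ∑ i', p i * p i' * (r ^ 2 * inner ℝ (g i) (g i')) +
      ∑ i, ∑ i', p i * p i' * ((z i ⬝ᵥ z i') * inner ℝ (g i) (g i')) := by
    simp only [← Finset.sum_sub_distrib, ← Finset.sum_add_distrib]
    exact Finset.sum_congr rfl fun i _ => Finset.sum_congr rfl fun i' _ => by ring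
  linarith

theorem integrable_iInf {Ω : Type*} [MeasurableSpace Ω] {μ : Measure Ω} {f : ι → Ω → ℝ}
    (hf : ∀ i, Integrable (f i) μ) : Integrable (fun ω => ⨅ i, f i ω) μ := by
  have h : Integrable (Finset.univ.inf' Finset.univ_nonempty f) μ :=
    Finset.inf'_induction (p := fun f => Integrable f μ) _ _ (fun _ h1 _ h2 => h1.inf h2) fun i _ => hf i
  refine h.congr (Eventually.of_forall fun ω => ?_)
  rw [Finset.inf'_apply, Finset.inf'_univ_eq_ciInf]

theorem integrable_dot (z : κ → ℝ) : Integrable (fun x : κ → ℝ => x ⬝ᵥ z) (stdGaussPi κ) :=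
  integrable_finsetSum _ fun k _ => (integrable_coord k).mul_const _

/-- Gordon's comparison inequality for a finite family of vectors of equal norm. -/
theorem gordon_comparison [DecidableEq κ] [DecidableEq τ] (e : OrthonormalBasis τ ℝ E)
    {z : ι → κ → ℝ} {r : ℝ} (hr : 0 ≤ r) (hz : ∀ i, z i ⬝ᵥ z i = r ^ 2) :
    r * ∫ x : τ → ℝ, ‖∑ j, x j • e j‖ ∂(stdGaussPi τ) +
        ∫ x : κ → ℝ, (⨅ i, x ⬝ᵥ z i) ∂(stdGaussPi κ) ≤
      ∫ x : τ × κ → ℝ, (⨅ i, ‖∑ jk, x jk • z i jk.2 • e jk.1‖) ∂(stdGaussPi (τ × κ)) := by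
  set A := ∫ x : τ → ℝ, ‖∑ j, x j • e j‖ ∂(stdGaussPi τ)
  set B := ∫ x : κ → ℝ, (⨅ i, x ⬝ᵥ z i) ∂(stdGaussPi κ)
  set D := ∫ x : τ × κ → ℝ, (⨅ i, ‖∑ jk, x jk • z i jk.2 • e jk.1‖) ∂(stdGaussPi (τ × κ))
  have iA : Integrable (fun x : τ → ℝ => ‖∑ j, x j • e j‖) (stdGaussPi τ) := integrable_norm_sum_smul _
  have iB : Integrable (fun x : κ → ℝ => ⨅ i, x ⬝ᵥ z i) (stdGaussPi κ) :=
    integrable_iInf fun i => integrable_dot _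
  have iD : Integrable (fun x : τ × κ → ℝ => ⨅ i, ‖∑ jk, x jk • z i jk.2 • e jk.1‖)
    (stdGaussPi (τ × κ)) := integrable_iInf fun i => integrable_norm_sum_smul _
  -- Scaling every vector by `T` multiplies the gap by `T`, while the `softMin` errors still total
  -- `1 + log (card ι)`.
  have key (T : ℝ) (hT : 0 < T) :
      T * (r * A + B - D) ≤ 1 + Real.log (Fintype.card ι) := by
    have hz' (i) : (T • z i) ⬝ᵥ (T • z i) = (T * r) ^ 2 := by
      simp only [smul_dotProduct, dotProduct_smul, hz, smul_eq_mul]; ring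
    have hc := integral_le_integral_of_trace_le (F := softMin (ι := ι) (E := E)) hasFDerivAt_softMin continuous_softMin'
      norm_softMin'_le hasDerivAt_softMin' continuous_softMin'' abs_softMin''_le
      (fun (jk : τ × κ) i => ((T • z i) jk.2 • e jk.1, 0))
      (Sum.elim (fun j _ => ((T * r) • e j, 0)) (fun k i => (0, (T • z i) k)))
      (sum_softMin''_le e hz')
    have hlip := abs_sub_le_of_hasFDerivAt (hasFDerivAt_softMin (ι := ι) (E := E)) norm_softMin'_le
    have iX := integrable_lipschitz_comp continuous_softMin hlip
      (fun (jk : τ × κ) (i : ι) => ((T • z i) jk.2 • e jk.1, 0))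
    have iY := integrable_lipschitz_comp continuous_softMin hlip (Sum.elim
      (fun j (_ : ι) => ((T * r) • e j, 0)) (fun k i => (0, (T • z i) k)))
    have mp := measurePreserving_sumPiEquivProdPi (fun _ : τ ⊕ κ => gaussianReal 0 1)
    have mp1 : MeasurePreserving (fun (x : τ ⊕ κ → ℝ) i => x (Sum.inl i))
        (stdGaussPi (τ ⊕ κ)) (stdGaussPi τ) := measurePreserving_fst.comp mp
    have mp2 : MeasurePreserving (fun (x : τ ⊕ κ → ℝ) i => x (Sum.inr i))
        (stdGaussPi (τ ⊕ κ)) (stdGaussPi κ) := measurePreserving_snd.comp mp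
    have hX : ∫ x : τ × κ → ℝ, softMin (∑ jk : τ × κ,
        x jk • fun (i : ι) => ((T • z i) jk.2 • e jk.1, (0 : ℝ))) ∂(stdGaussPi (τ × κ)) ≤ T * D + 1 := by
      have : T * D + 1 = ∫ x : τ × κ → ℝ, (T * (⨅ i, ‖∑ jk, x jk • z i jk.2 • e jk.1‖) + 1)
          ∂(stdGaussPi (τ × κ)) := by
        rw [integral_add (iD.const_mul _) (integrable_const _), integral_const_mul]; simp [D]
      rw [this]
      refine integral_mono iX ((iD.const_mul _).add (integrable_const _)) fun x => ?_
      refine (softMin_le _).trans (le_of_eq ?_)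
      rw [Real.mul_iInf_of_nonneg hT.le]
      congr 2
      ext i
      simp only [Finset.sum_apply, Pi.smul_apply, Prod.fst_sum, Prod.snd_sum, Prod.smul_fst,
        Prod.smul_snd, smul_zero, Finset.sum_const_zero, add_zero]
      rw [← norm_smul_of_nonneg hT.le, Finset.smul_sum]
      congr 1
      exact Finset.sum_congr rfl fun jk _ => by module
    have hY : T * r * A + T * B - Real.log (Fintype.card ι) ≤ ∫ x : τ ⊕ κ → ℝ, softMin (∑ j : τ ⊕ κ,
        x j • (Sum.elim (fun j (_ : ι) => ((T * r) • e j, (0 : ℝ))) (fun k i => ((0 : E), (T • z i) k))) j)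
        ∂(stdGaussPi (τ ⊕ κ)) := by
      have iA' : Integrable (fun x : τ ⊕ κ → ℝ => ‖∑ j, x (Sum.inl j) • e j‖)
        (stdGaussPi (τ ⊕ κ)) := mp1.integrable_comp_of_integrable iA
      have iB' : Integrable (fun x : τ ⊕ κ → ℝ => ⨅ i, (fun k => x (Sum.inr k)) ⬝ᵥ z i)
        (stdGaussPi (τ ⊕ κ)) := mp2.integrable_comp_of_integrable iB
      have eA : A = ∫ x : τ ⊕ κ → ℝ, ‖∑ j, x (Sum.inl j) • e j‖ ∂(stdGaussPi (τ ⊕ κ)) := by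
        simp only [A]
        rw [← mp1.map_eq, integral_map mp1.measurable.aemeasurable
          (by rw [mp1.map_eq]; exact iA.aestronglyMeasurable)]
      have eB : B = ∫ x : τ ⊕ κ → ℝ, (⨅ i, (fun k => x (Sum.inr k)) ⬝ᵥ z i) ∂(stdGaussPi (τ ⊕ κ)) := by
        simp only [B]
        rw [← mp2.map_eq, integral_map mp2.measurable.aemeasurable
          (by rw [mp2.map_eq]; exact iB.aestronglyMeasurable)]
      have : T * r * A + T * B - Real.log (Fintype.card ι) = ∫ x : τ ⊕ κ → ℝ,
          (T * r * ‖∑ j, x (Sum.inl j) • e j‖ + T * (⨅ i, (fun k => x (Sum.inr k)) ⬝ᵥ z i) -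
            Real.log (Fintype.card ι)) ∂(stdGaussPi (τ ⊕ κ)) := by
        have h := integral_sub ((iA'.const_mul (T * r)).add (iB'.const_mul T))
          (integrable_const (Real.log (Fintype.card ι)))
        have h' := integral_add (iA'.const_mul (T * r)) (iB'.const_mul T)
        simp only [Pi.add_apply] at h
        rw [h, h', integral_const_mul, integral_const_mul, ← eA, ← eB]
        simp
      rw [this]
      refine integral_mono (((iA'.const_mul _).add (iB'.const_mul _)).sub (integrable_const _)) iY
        fun x => ?_
      refine le_trans (le_of_eq ?_) (le_softMin _)
      rw [Real.mul_iInf_of_nonneg hT.le]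
      congr 1
      have hn : T * r * ‖∑ j, x (Sum.inl j) • e j‖ = ‖∑ j, x (Sum.inl j) • (T * r) • e j‖ := by
        rw [← norm_smul_of_nonneg (mul_nonneg hT.le hr), Finset.smul_sum]
        congr 1
        exact Finset.sum_congr rfl fun jk _ => by module
      rw [hn, add_ciInf (Set.finite_range _).bddBelow]
      congr 1
      ext i
      simp [Finset.sum_apply, Prod.fst_sum, Prod.snd_sum, dotProduct, Finset.mul_sum]
      exact Finset.sum_congr rfl fun k _ => by ring
    linarith [hX, hY, hc]
  by_contra! hcon
  have hpos : 0 < r * A + B - D := by linarith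
  have hlog : 0 ≤ Real.log (Fintype.card ι) := Real.log_natCast_nonneg _
  -- This `T` turns a positive gap into `2 + log (card ι)`, one more than `key` allows.
  have h1 := key ((2 + Real.log (Fintype.card ι)) / (r * A + B - D)) (by positivity)
  rw [div_mul_cancel₀ _ hpos.ne'] at h1
  linarith

end Gordon

/-! ### The scalar dual problem and its Gaussian mean. -/

section NormalCdf

theorem hasDerivAt_erf (x : ℝ) : HasDerivAt erf (2 / √Real.pi * Real.exp (-x ^ 2)) x := by
  have hc : Continuous fun t : ℝ => Real.exp (-t ^ 2) := by fun_prop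
  exact (intervalIntegral.integral_hasDerivAt_right (hc.intervalIntegrable _ _)
    (hc.stronglyMeasurableAtFilter _ _) hc.continuousAt).const_mul _

theorem erf_neg (x : ℝ) : erf (-x) = -erf x := by
  have h := intervalIntegral.integral_comp_neg (a := 0) (b := x) fun t : ℝ => Real.exp (-t ^ 2)
  simp only [neg_sq, neg_zero] at h
  rw [erf, erf, h, intervalIntegral.integral_symm]
  ring

theorem tendsto_erf_atTop : Tendsto erf atTop (𝓝 1) := by
  have hi : Integrable fun t : ℝ => Real.exp (-t ^ 2) := by
    simpa using integrable_exp_neg_mul_sq (b := 1) one_pos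
  have h := (intervalIntegral_tendsto_integral_Ioi 0 hi.integrableOn tendsto_id).const_mul
    (2 / √Real.pi)
  have e : ∫ t in Set.Ioi (0 : ℝ), Real.exp (-t ^ 2) = √Real.pi / 2 := by
    simpa using integral_gaussian_Ioi 1
  rw [e] at h
  have hp : √Real.pi ≠ 0 := (Real.sqrt_pos.2 Real.pi_pos).ne'
  rw [div_mul_div_comm, mul_comm 2, div_self (mul_ne_zero hp two_ne_zero)] at h
  exact h

theorem tendsto_erf_atBot : Tendsto erf atBot (𝓝 (-1)) := by
  have h := (tendsto_erf_atTop.comp tendsto_neg_atBot_atTop).neg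
  refine h.congr fun x => ?_
  simp [erf_neg]

/-- The standard normal distribution function. -/
noncomputable def normalCdf (x : ℝ) : ℝ := (1 + erf (x / √2)) / 2

theorem gaussianPDFReal_std (x : ℝ) :
    gaussianPDFReal 0 1 x = Real.exp (-(1 / 2) * x ^ 2) / √(2 * Real.pi) := by
  rw [gaussianPDFReal]
  simp only [NNReal.coe_one, mul_one, sub_zero]
  rw [show -(1 / 2) * x ^ 2 = -x ^ 2 / 2 by ring, div_eq_inv_mul (Real.exp _)]

theorem hasDerivAt_normalCdf (x : ℝ) : HasDerivAt normalCdf (gaussianPDFReal 0 1 x) x := by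
  have h := (((hasDerivAt_erf (x / √2)).comp x ((hasDerivAt_id x).div_const √2)).const_add 1).div_const 2
  refine h.congr_deriv ?_
  rw [gaussianPDFReal_std, div_pow, Real.sq_sqrt zero_le_two, Real.sqrt_mul zero_le_two,
    show -(1 / 2) * x ^ 2 = -(x ^ 2 / 2) by ring]
  ring

theorem tendsto_normalCdf_atTop : Tendsto normalCdf atTop (𝓝 1) := by
  have h := ((tendsto_erf_atTop.comp
    (tendsto_id.atTop_div_const (Real.sqrt_pos.2 zero_lt_two))).const_add 1).div_const 2
  norm_num at h
  exact h

theorem tendsto_normalCdf_atBot : Tendsto normalCdf atBot (𝓝 0) := by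
  have h := ((tendsto_erf_atBot.comp
    (tendsto_id.atBot_div_const (Real.sqrt_pos.2 zero_lt_two))).const_add 1).div_const 2
  norm_num at h
  exact h

theorem tendsto_gaussianPDFReal_atTop : Tendsto (gaussianPDFReal 0 1) atTop (𝓝 0) := by
  simp only [funext gaussianPDFReal_std]
  rw [← zero_div (√(2 * Real.pi))]
  refine (Real.tendsto_exp_atBot.comp ?_).div_const _
  exact (tendsto_pow_atTop two_ne_zero).const_mul_atTop_of_neg (by norm_num)

theorem tendsto_gaussianPDFReal_atBot : Tendsto (gaussianPDFReal 0 1) atBot (𝓝 0) := by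
  refine (tendsto_gaussianPDFReal_atTop.comp tendsto_neg_atBot_atTop).congr fun x => ?_
  simp [gaussianPDFReal_std]

theorem integrable_pow_gaussianReal (k : ℕ) : Integrable (fun x : ℝ => x ^ k) (gaussianReal 0 1) := by
  have h := (memLp_id_gaussianReal' (μ := 0) (v := 1) (k : ℝ≥0∞) (by simp)).integrable_norm_pow'
  refine (integrable_norm_iff (by fun_prop)).1 (h.congr (Eventually.of_forall fun x => ?_))
  simp

theorem setIntegral_gaussianReal_eq {s : Set ℝ} (hs : MeasurableSet s) (f : ℝ → ℝ) :
    ∫ x, s.indicator f x ∂(gaussianReal 0 1) = ∫ x in s, f x * gaussianPDFReal 0 1 x := by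
  rw [integral_gaussianReal_eq, ← integral_indicator hs]
  congr 1; ext x
  by_cases hx : x ∈ s <;> simp [hx]

theorem integral_Iic_affine_gaussianReal (a c : ℝ) :
    ∫ x, (Set.Iic a).indicator (fun x => c + x) x ∂(gaussianReal 0 1) =
      c * normalCdf a - gaussianPDFReal 0 1 a := by
  rw [setIntegral_gaussianReal_eq measurableSet_Iic]
  have hi : Integrable (fun x : ℝ => c + x) (gaussianReal 0 1) :=
    (integrable_const c).add integrable_id_gaussianReal
  have h := integral_Iic_of_hasDerivAt_of_tendsto (a := a) (m := 0)
    (f := fun x => c * normalCdf x - gaussianPDFReal 0 1 x)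
    (f' := fun x => (c + x) * gaussianPDFReal 0 1 x)
    (((hasDerivAt_normalCdf a).continuousAt.const_mul c).sub
      (hasDerivAt_gaussianPDFReal a).continuousAt).continuousWithinAt
    (fun x _ => (((hasDerivAt_normalCdf x).const_mul c).sub
      (hasDerivAt_gaussianPDFReal x)).congr_deriv (by ring))
    (integrable_gaussianReal_iff.1 hi).integrableOn
    (by simpa using (tendsto_normalCdf_atBot.const_mul c).sub tendsto_gaussianPDFReal_atBot)
  rw [h, sub_zero]

theorem integral_Ioi_affine_gaussianReal (b c : ℝ) :
    ∫ x, (Set.Ioi b).indicator (fun x => c - x) x ∂(gaussianReal 0 1) =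
      c * (1 - normalCdf b) - gaussianPDFReal 0 1 b := by
  rw [setIntegral_gaussianReal_eq measurableSet_Ioi]
  have hi : Integrable (fun x : ℝ => c - x) (gaussianReal 0 1) :=
    (integrable_const c).sub integrable_id_gaussianReal
  have h := integral_Ioi_of_hasDerivAt_of_tendsto (a := b) (m := c)
    (f := fun x => c * normalCdf x + gaussianPDFReal 0 1 x)
    (f' := fun x => (c - x) * gaussianPDFReal 0 1 x)
    (((hasDerivAt_normalCdf b).continuousAt.const_mul c).add
      (hasDerivAt_gaussianPDFReal b).continuousAt).continuousWithinAt
    (fun x _ => (((hasDerivAt_normalCdf x).const_mul c).add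
      (hasDerivAt_gaussianPDFReal x)).congr_deriv (by ring))
    (integrable_gaussianReal_iff.1 hi).integrableOn
    (by simpa using (tendsto_normalCdf_atTop.const_mul c).add tendsto_gaussianPDFReal_atTop)
  rw [h]; ring

theorem continuous_gaussianPDFReal : Continuous (gaussianPDFReal 0 1) :=
  continuous_iff_continuousAt.2 fun x => (hasDerivAt_gaussianPDFReal x).continuousAt

theorem integral_sq_gaussianPDFReal (a b ν : ℝ) :
    ∫ x in a..b, (x + ν) ^ 2 * gaussianPDFReal 0 1 x =
      (ν ^ 2 + 1) * (normalCdf b - normalCdf a) - (b + 2 * ν) * gaussianPDFReal 0 1 b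
        + (a + 2 * ν) * gaussianPDFReal 0 1 a := by
  have hc := continuous_gaussianPDFReal
  rw [intervalIntegral.integral_eq_sub_of_hasDerivAt
    (f := fun x => (ν ^ 2 + 1) * normalCdf x - (x + 2 * ν) * gaussianPDFReal 0 1 x)
    (fun x _ => (((hasDerivAt_normalCdf x).const_mul (ν ^ 2 + 1)).sub
      (((hasDerivAt_id x).add_const (2 * ν)).mul (hasDerivAt_gaussianPDFReal x))).congr_deriv
        (by simp only [id]; ring))
    (Continuous.intervalIntegrable (by fun_prop) _ _)]
  ring

/-- A lower bound for `min_{|t| ≤ 1} ((h + ν) t + γ t²)`, with equality for `γ ≥ 0`. -/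
noncomputable def boxDual (γ ν h : ℝ) : ℝ :=
  (Set.Iic (-(ν + 2 * γ))).indicator (fun h => (ν + γ) + h) h
    + (Set.Ioi (2 * γ - ν)).indicator (fun h => -(ν - γ) - h) h
    - ((Set.Ioc (-(ν + 2 * γ)) (2 * γ - ν)).indicator (fun h => (h + ν) ^ 2) h
      - (Set.Ioc (2 * γ - ν) (-(ν + 2 * γ))).indicator (fun h => (h + ν) ^ 2) h) / (4 * γ)

/-- For `γ > 0` the unconstrained minimizer `-(h + ν) / (2γ)` lies in `[-1, 1]` exactly between the
two thresholds; outside them an endpoint is optimal. For `γ < 0` the thresholds cross and both tail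
terms act on the overlap, yet their sum with the sign-reversed quadratic term remains a lower bound.
Hence `γ` needs no sign restriction. -/
theorem boxDual_le (γ ν h : ℝ) {t : ℝ} (ht : t ∈ Set.Icc (-1 : ℝ) 1) :
    boxDual γ ν h ≤ (h + ν) * t + γ * t ^ 2 := by
  obtain ⟨h1, h2⟩ := ht
  simp only [boxDual, Set.indicator_apply, Set.mem_Iic, Set.mem_Ioi, Set.mem_Ioc]
  rcases lt_trichotomy γ 0 with hγ | rfl | hγ
  · rcases le_or_gt h (2 * γ - ν) with hb | hb
    · rw [if_pos (by linarith), if_neg (by linarith), if_neg (by simp; intros; linarith),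
        if_neg (by simp; intros; linarith)]
      simp only [sub_zero, zero_div, add_zero]
      nlinarith [mul_nonneg (sub_nonneg.2 h2) (by nlinarith : 0 ≤ -(h + ν + γ * (t + 1)))]
    · rcases le_or_gt h (-(ν + 2 * γ)) with ha | ha
      · rw [if_pos ha, if_pos hb, if_neg (by simp; intros; linarith), if_pos ⟨hb, ha⟩]
        rw [zero_sub, neg_div, sub_neg_eq_add]
        -- On the overlap the slack is a square plus a multiple of `1 - t²`, both nonnegative for `γ
        -- < 0`.
        have e : (h + ν) * t + γ * t ^ 2 - (ν + γ + h + (-(ν - γ) - h) + (h + ν) ^ 2 / (4 * γ)) =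
            (h + ν - 2 * γ * t) ^ 2 / (4 * -γ) + 2 * -γ * (1 - t ^ 2) := by
          have := hγ.ne
          field_simp; ring
        have p1 : 0 ≤ (h + ν - 2 * γ * t) ^ 2 / (4 * -γ) :=
          div_nonneg (sq_nonneg _) (by linarith)
        have p2 : 0 ≤ 2 * -γ * (1 - t ^ 2) := mul_nonneg (by linarith) (by nlinarith)
        linarith
      · rw [if_neg (by linarith), if_pos hb, if_neg (by simp; intros; linarith),
          if_neg (by simp; intros; linarith)]
        simp only [sub_zero, zero_div, zero_add]
        nlinarith [mul_nonneg (by linarith : 0 ≤ t + 1) (by nlinarith : 0 ≤ h + ν + γ * (t - 1))]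
  -- The thresholds coincide here, so the quadratic part is empty and division by zero discards
  -- nothing.
  · simp only [mul_zero, div_zero]
    split_ifs <;> nlinarith
  · rcases le_or_gt h (-(ν + 2 * γ)) with ha | ha
    · rw [if_pos ha, if_neg (by linarith), if_neg (by simp; intros; linarith),
        if_neg (by simp; intros; linarith)]
      simp only [sub_zero, zero_div, add_zero]
      nlinarith [mul_nonneg (sub_nonneg.2 h2) (by nlinarith : 0 ≤ -(h + ν + γ * (t + 1)))]
    · rcases le_or_gt h (2 * γ - ν) with hb | hb
      · rw [if_neg (by linarith), if_neg (by linarith), if_pos ⟨ha, hb⟩,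
          if_neg (by simp; intros; linarith)]
        have e : (h + ν) * t + γ * t ^ 2 - (0 + 0 - ((h + ν) ^ 2 - 0) / (4 * γ)) =
            (h + ν + 2 * γ * t) ^ 2 / (4 * γ) := by
          field_simp; ring
        have p1 : 0 ≤ (h + ν + 2 * γ * t) ^ 2 / (4 * γ) := by positivity
        linarith
      · rw [if_neg (by linarith), if_pos hb, if_neg (by simp; intros; linarith),
          if_neg (by simp; intros; linarith)]
        simp only [sub_zero, zero_div, zero_add]
        nlinarith [mul_nonneg (by linarith : 0 ≤ t + 1) (by nlinarith : 0 ≤ h + ν + γ * (t - 1))]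

theorem integrable_sq_add_gaussianReal (ν : ℝ) :
    Integrable (fun h : ℝ => (h + ν) ^ 2) (gaussianReal 0 1) := by
  have := (((integrable_pow_gaussianReal 2).add
    (integrable_id_gaussianReal.const_mul (2 * ν))).add (integrable_const (ν ^ 2)))
  refine this.congr (Eventually.of_forall fun h => ?_)
  simp only [Pi.add_apply]; ring

theorem integrable_boxDual (γ ν : ℝ) : Integrable (boxDual γ ν) (gaussianReal 0 1) := by
  have i3 := integrable_sq_add_gaussianReal ν
  exact ((((integrable_const _).add integrable_id_gaussianReal).indicator measurableSet_Iic).add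
    (((integrable_const _).sub integrable_id_gaussianReal).indicator measurableSet_Ioi)).sub
    (((i3.indicator measurableSet_Ioc).sub (i3.indicator measurableSet_Ioc)).div_const _)

theorem integral_boxDual (γ ν : ℝ) :
    ∫ h, boxDual γ ν h ∂(gaussianReal 0 1) = I22 γ ν - I1 γ ν + I21 γ ν := by
  have i3 := integrable_sq_add_gaussianReal ν
  have j1 : Integrable ((Set.Iic (-(ν + 2 * γ))).indicator (fun h => (ν + γ) + h)) (gaussianReal 0 1) :=
    ((integrable_const _).add integrable_id_gaussianReal).indicator measurableSet_Iic
  have j2 : Integrable ((Set.Ioi (2 * γ - ν)).indicator (fun h => -(ν - γ) - h)) (gaussianReal 0 1) :=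
    ((integrable_const _).sub integrable_id_gaussianReal).indicator measurableSet_Ioi
  have j3 (a b : ℝ) := i3.indicator (measurableSet_Ioc (a := a) (b := b))
  have s1 := integral_sub (j1.add j2) (((j3 (-(ν + 2 * γ)) (2 * γ - ν)).sub
    (j3 (2 * γ - ν) (-(ν + 2 * γ)))).div_const (4 * γ))
  have s2 := integral_add j1 j2
  have s3 := integral_sub (j3 (-(ν + 2 * γ)) (2 * γ - ν)) (j3 (2 * γ - ν) (-(ν + 2 * γ)))
  simp only [Pi.add_apply, Pi.sub_apply] at s1
  unfold boxDual
  -- The difference of the two `Ioc` integrals is the oriented interval integral, so one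
  -- antiderivative serves both signs of `γ`. The left tail gives `I22`, the right tail `I21` and
  -- the middle `I1`.
  rw [s1, s2, integral_div, s3, integral_Iic_affine_gaussianReal,
    integral_Ioi_affine_gaussianReal, setIntegral_gaussianReal_eq measurableSet_Ioc,
    setIntegral_gaussianReal_eq measurableSet_Ioc, ← intervalIntegral,
    integral_sq_gaussianPDFReal]
  have ea : erf (-(ν + 2 * γ) / √2) = -erf ((ν + 2 * γ) / √2) := by rw [neg_div, erf_neg]
  have eb : erf ((2 * γ - ν) / √2) = -erf ((ν - 2 * γ) / √2) := by
    rw [← erf_neg]; congr 1; ring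
  have es : √(Real.pi / 2) = √(2 * Real.pi) / 2 := by
    rw [show Real.pi / 2 = (2 * Real.pi) / 2 ^ 2 by ring, Real.sqrt_div (by positivity),
      Real.sqrt_sq zero_le_two]
  have hs : √(2 * Real.pi) ≠ 0 := by positivity
  simp only [normalCdf, ea, eb, gaussianPDFReal_std, I22, I1, I21, erfc, es]
  rw [show (-(ν + 2 * γ)) ^ 2 = (ν + 2 * γ) ^ 2 by ring,
    show (2 * γ - ν) ^ 2 = (ν - 2 * γ) ^ 2 by ring, show 2 * γ + ν = ν + 2 * γ by ring]
  rcases eq_or_ne γ 0 with rfl | hγ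
  · simp; ring
  · field_simp
    ring

end NormalCdf

/-! ### The expected norm of a Gaussian vector. -/

/-- With `y = √s` the difference of the two sides is `y (y + 2) (y - 1)² / 2`. Applied to `s = ‖x‖²
/ m`, the linear term has mean zero and the quadratic one costs only `O(1/m)`. -/
theorem le_sqrt_of_nonneg {s : ℝ} (hs : 0 ≤ s) : 1 + (s - 1) / 2 - (s - 1) ^ 2 / 2 ≤ √s := by
  have h := Real.sq_sqrt hs
  set y := √s
  have hy : 0 ≤ y := Real.sqrt_nonneg s
  rw [← h]
  nlinarith [mul_nonneg (mul_nonneg hy (by linarith : 0 ≤ y + 2)) (sq_nonneg (y - 1))]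

/-- The expected norm of a standard Gaussian vector is asymptotically at least `√m`. -/
theorem sqrt_mul_le_integral_norm {τ : Type*} [Fintype τ] [DecidableEq τ] [Nonempty τ] :
    √(Fintype.card τ) * (1 - Var[fun x => x ^ 2; gaussianReal 0 1] / 2 / Fintype.card τ) ≤
      ∫ x : τ → ℝ, ‖∑ j, x j • EuclideanSpace.basisFun τ ℝ j‖ ∂(stdGaussPi τ) := by
  set v := Var[fun x => x ^ 2; gaussianReal 0 1]
  set m : ℝ := (Fintype.card τ : ℝ)
  have hm : 0 < m := by simp only [m]; exact_mod_cast Fintype.card_pos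
  have hL : MemLp (fun x : ℝ => x ^ 2) 2 (gaussianReal 0 1) := by
    rw [memLp_two_iff_integrable_sq (by fun_prop)]
    refine (integrable_pow_gaussianReal 4).congr (Eventually.of_forall fun x => ?_)
    simp only; ring
  have hvar := variance_sum_pi (μ := fun _ : τ => gaussianReal 0 1) (X := fun _ x => x ^ 2)
    (fun _ => hL)
  rw [Finset.sum_const, Finset.card_univ, nsmul_eq_mul] at hvar
  have hL' (j : τ) : MemLp (fun x : τ → ℝ => x j ^ 2) 2 (stdGaussPi τ) :=
    hL.comp_measurePreserving (measurePreserving_eval_gauss j)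
  have hLs : MemLp (fun x : τ → ℝ => ∑ j, x j ^ 2) 2 (stdGaussPi τ) :=
    memLp_finsetSum _ fun j _ => hL' j
  have hone : ∫ x : ℝ, x ^ 2 ∂(gaussianReal 0 1) = 1 := by
    have h := variance_fun_id_gaussianReal (μ := 0) (v := 1)
    rw [variance_of_integral_eq_zero (by fun_prop) integral_id_gaussianReal] at h
    simpa using h
  have hmean : ∫ x : τ → ℝ, ∑ j, x j ^ 2 ∂(stdGaussPi τ) = m := by
    rw [integral_finsetSum _ fun j _ => (hL' j).integrable (by norm_num)]
    have (j : τ) : ∫ x : τ → ℝ, x j ^ 2 ∂(stdGaussPi τ) = 1 := by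
      rw [← hone, ← (measurePreserving_eval_gauss j).map_eq,
        integral_map (measurable_pi_apply j).aemeasurable (by fun_prop)]
    simp [this, m]
  have hvs : ∫ x : τ → ℝ, (∑ j, x j ^ 2 - m) ^ 2 ∂(stdGaussPi τ) = m * v := by
    have h := variance_eq_integral hLs.aestronglyMeasurable.aemeasurable
    rw [hmean] at h
    rw [← h, ← hvar]
    congr 1
    ext x
    simp
  have i1 : Integrable (fun x : τ → ℝ => ∑ j, x j ^ 2 - m) (stdGaussPi τ) :=
    (hLs.integrable (by norm_num)).sub (integrable_const _)
  have i2 : Integrable (fun x : τ → ℝ => (∑ j, x j ^ 2 - m) ^ 2) (stdGaussPi τ) :=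
    (hLs.sub (memLp_const m)).integrable_sq
  have hlow : ∫ x : τ → ℝ, √m * (1 + (∑ j, x j ^ 2 - m) / (2 * m)
      - (∑ j, x j ^ 2 - m) ^ 2 / (2 * m ^ 2)) ∂(stdGaussPi τ) = √m * (1 - v / 2 / m) := by
    have s1 := integral_sub ((integrable_const (μ := stdGaussPi τ) (1 : ℝ)).add (i1.div_const (2 * m)))
      (i2.div_const (2 * m ^ 2))
    have s2 := integral_add (integrable_const (μ := stdGaussPi τ) (1 : ℝ)) (i1.div_const (2 * m))
    simp only [Pi.add_apply] at s1
    have s3 : ∫ x : τ → ℝ, (∑ j, x j ^ 2 - m) ∂(stdGaussPi τ) = 0 := by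
      rw [integral_sub (hLs.integrable (by norm_num)) (integrable_const _), hmean]; simp
    rw [integral_const_mul, s1, s2, integral_div, integral_div, hvs, s3]
    simp
    left
    field_simp
  rw [← hlow]
  refine integral_mono (((((integrable_const _).add (i1.div_const _)).sub
    (i2.div_const _))).const_mul _) (integrable_norm_sum_smul _) fun x => ?_
  have hn : ‖∑ j, x j • EuclideanSpace.basisFun τ ℝ j‖ = √(∑ j, x j ^ 2) := by
    rw [EuclideanSpace.norm_eq]
    congr 1
    refine Finset.sum_congr rfl fun i _ => ?_
    simp [Finset.sum_apply, Pi.single_apply]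
  simp only [hn]
  have hs := le_sqrt_of_nonneg (s := (∑ j, x j ^ 2) / m) (by positivity)
  have e : √(∑ j, x j ^ 2) = √m * √((∑ j, x j ^ 2) / m) := by
    rw [← Real.sqrt_mul hm.le, mul_div_cancel₀ _ hm.ne']
  rw [e]
  refine mul_le_mul_of_nonneg_left (le_trans (le_of_eq ?_) hs) (Real.sqrt_nonneg _)
  field_simp

/-! ### From Gordon's inequality to the random dual. -/

/-- The family of entries of `[A v]`. -/
def joinEntries {m n : ℕ} (p : (Fin m → Fin n → ℝ) × (Fin m → ℝ)) (jk : Fin m × Option (Fin n)) : ℝ :=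
  jk.2.elim (p.2 jk.1) (p.1 jk.1)

theorem measurePreserving_joinEntries (m n : ℕ) :
    MeasurePreserving (joinEntries (m := m) (n := n)) ((gaussMatrix m n).prod (gaussVector m))
      (stdGaussPi (Fin m × Option (Fin n))) := by
  have hm : Measurable (joinEntries (m := m) (n := n)) := by
    refine measurable_pi_lambda _ fun ⟨i, k⟩ => ?_
    cases k <;> simp only [joinEntries, Option.elim] <;> fun_prop
  refine ⟨hm, (Measure.pi_eq fun s hs => ?_).symm⟩
  rw [Measure.map_apply hm (MeasurableSet.univ_pi hs)]
  have : joinEntries ⁻¹' (Set.univ.pi s) =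
      (Set.univ.pi fun i : Fin m => Set.univ.pi fun j : Fin n => s (i, some j)) ×ˢ
        (Set.univ.pi fun i : Fin m => s (i, none)) := by
    ext p
    simp only [Set.mem_preimage, Set.mem_pi, Set.mem_univ, true_imp_iff, Set.mem_prod, Prod.forall,
      Option.forall, joinEntries, Option.elim]
    exact ⟨fun h => ⟨fun i => (h i).2, fun i => (h i).1⟩, fun h i => ⟨h.2 i, h.1 i⟩⟩
  rw [this, gaussMatrix, gaussVector, Measure.prod_prod, Measure.pi_pi, Measure.pi_pi,
    Fintype.prod_prod_type]
  simp only [Measure.pi_pi, Fintype.prod_option]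
  rw [Finset.prod_mul_distrib, mul_comm]

/-- The coefficients of the entries of `[A v]` in the residual, up to sign. -/
noncomputable def errorVec {n : ℕ} (σ : ℝ) (x : Fin n → ℝ) (k : Option (Fin n)) : ℝ :=
  k.elim (-σ) fun j => x j - xSol n j

theorem norm_le_maxUnit {m : ℕ} (w : Fin m → ℝ) : √(w ⬝ᵥ w) ≤ maxUnit w := by
  have hw : 0 ≤ w ⬝ᵥ w := Finset.sum_nonneg fun i _ => mul_self_nonneg _
  have hcs (l : Fin m → ℝ) (hl : l ⬝ᵥ l = 1) : l ⬝ᵥ w ≤ 1 + w ⬝ᵥ w := by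
    have h : 0 ≤ (l - w) ⬝ᵥ (l - w) := Finset.sum_nonneg fun i _ => mul_self_nonneg _
    rw [sub_dotProduct, dotProduct_sub, dotProduct_sub, hl, dotProduct_comm w l] at h
    linarith
  rcases hw.eq_or_lt with h0 | h0
  · have hz : w = 0 := dotProduct_self_eq_zero.1 h0.symm
    rw [← h0, Real.sqrt_zero]
    -- This also covers `m = 0`, where there is no unit vector and the supremum defaults to `0`.
    exact Real.iSup_nonneg fun l => by simp [hz]
  · have hs := Real.sqrt_pos.2 h0
    have hsq := Real.mul_self_sqrt hw
    have hb : BddAbove (Set.range fun l : {l : Fin m → ℝ // l ⬝ᵥ l = 1} => (l : Fin m → ℝ) ⬝ᵥ w) :=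
      ⟨1 + w ⬝ᵥ w, by rintro _ ⟨l, rfl⟩; exact hcs l l.2⟩
    have hl : ((√(w ⬝ᵥ w))⁻¹ • w) ⬝ᵥ ((√(w ⬝ᵥ w))⁻¹ • w) = 1 := by
      rw [smul_dotProduct, dotProduct_smul, smul_eq_mul, smul_eq_mul]
      nth_rw 3 [← hsq]
      field_simp
    refine le_trans (le_of_eq ?_) (le_ciSup hb ⟨_, hl⟩)
    simp only [smul_dotProduct, smul_eq_mul]
    nth_rw 3 [← hsq]
    field_simp

theorem norm_sum_joinEntries {m n : ℕ} (σ : ℝ) (p : (Fin m → Fin n → ℝ) × (Fin m → ℝ))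
    (x : Fin n → ℝ) :
    ‖∑ jk, joinEntries p jk • errorVec σ x jk.2 • EuclideanSpace.basisFun (Fin m) ℝ jk.1‖ ≤
      maxUnit (Matrix.of p.1 *ᵥ (xSol n - x) + σ • p.2) := by
  refine le_trans (le_of_eq ?_) (norm_le_maxUnit _)
  rw [EuclideanSpace.norm_eq]
  congr 1
  rw [dotProduct]
  refine Finset.sum_congr rfl fun i _ => ?_
  have : (∑ jk, joinEntries p jk • errorVec σ x jk.2 • EuclideanSpace.basisFun (Fin m) ℝ jk.1) i =
      -((Matrix.of p.1 *ᵥ (xSol n - x) + σ • p.2) i) := by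
    rw [Fintype.sum_prod_type]
    simp only [Fintype.sum_option, joinEntries, errorVec, Option.elim]
    simp [Finset.sum_apply, Pi.single_apply, Finset.sum_add_distrib, Matrix.mulVec, dotProduct]
    rw [add_comm, ← sub_eq_add_neg, mul_comm, ← sub_eq_neg_add]
    congr 1
    rw [← Finset.sum_neg_distrib]
    exact Finset.sum_congr rfl fun j _ => by ring
  rw [this, Real.norm_eq_abs, abs_neg, sq_abs, sq]

theorem errorVec_dot_self {n : ℕ} (hn : n ≠ 0) (σ : ℝ) {c₂ c₁ : ℝ} {x : Fin n → ℝ}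
    (hx : x ∈ feasibleSet n c₂ c₁) :
    errorVec σ x ⬝ᵥ errorVec σ x = 1 - 2 * c₁ + c₂ + σ ^ 2 := by
  obtain ⟨-, h1, h2⟩ := hx
  have h3 : xSol n ⬝ᵥ xSol n = 1 := by
    have : (n : ℝ) ≠ 0 := by exact_mod_cast hn
    simp [dotProduct, xSol, ← mul_inv, this]
  have : errorVec σ x ⬝ᵥ errorVec σ x = σ ^ 2 + (x - xSol n) ⬝ᵥ (x - xSol n) := by
    simp only [dotProduct, errorVec, Fintype.sum_option, Option.elim, Pi.sub_apply]
    ring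
  rw [this, sub_dotProduct, dotProduct_sub, dotProduct_sub, h2, h3, dotProduct_comm x, h1]
  ring

/-- Weak duality: with `t = √n * x j ∈ [-1, 1]`, summing `boxDual_le` over coordinates turns the `ν`
and `γ` terms into the constraint values `n c₁` and `n c₂`. The remainder `y ⬝ᵥ errorVec σ 0` does
not depend on `x` and has mean zero. -/
theorem le_dot_of_mem_feasibleSet {n : ℕ} (hn : n ≠ 0) (γ ν σ : ℝ) {c₂ c₁ : ℝ} {x : Fin n → ℝ}
    (hx : x ∈ feasibleSet n c₂ c₁) (y : Option (Fin n) → ℝ) :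
    (∑ j, boxDual γ ν (y (some j))) / √n - √n * (ν * c₁ + γ * c₂)
      + y ⬝ᵥ errorVec σ (0 : Fin n → ℝ) ≤ y ⬝ᵥ errorVec σ x := by
  obtain ⟨hb, h1, h2⟩ := hx
  have hs : 0 < √(n : ℝ) := Real.sqrt_pos.2 (by positivity)
  have hsq : √(n : ℝ) * √(n : ℝ) = n := Real.mul_self_sqrt (by positivity)
  have hx1 : ∑ j, x j = √n * c₁ := by
    rw [← h1]
    simp only [dotProduct, xSol]
    rw [← Finset.mul_sum]
    field_simp
  have hx2 : ∑ j, x j ^ 2 = c₂ := by simp only [← h2, dotProduct, sq]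
  have he : y ⬝ᵥ errorVec σ x = ∑ j, y (some j) * x j + y ⬝ᵥ errorVec σ (0 : Fin n → ℝ) := by
    simp only [dotProduct, errorVec, Fintype.sum_option, Option.elim, Pi.zero_apply]
    rw [add_left_comm, ← Finset.sum_add_distrib]
    congr 1
    exact Finset.sum_congr rfl fun j _ => by ring
  have hj (j : Fin n) : boxDual γ ν (y (some j)) ≤
      √n * (y (some j) * x j) + ν * √n * x j + γ * n * x j ^ 2 := by
    obtain ⟨hl, hu⟩ := hb j
    have ht : √n * x j ∈ Set.Icc (-1 : ℝ) 1 := by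
      have e : √(n : ℝ) * (1 / √n) = 1 := mul_one_div_cancel hs.ne'
      constructor
      · have := mul_le_mul_of_nonneg_left hl hs.le
        rwa [mul_neg, e] at this
      · have := mul_le_mul_of_nonneg_left hu hs.le
        rwa [e] at this
    refine (boxDual_le γ ν (y (some j)) ht).trans (le_of_eq ?_)
    linear_combination γ * x j ^ 2 * hsq
  have hsum := Finset.sum_le_sum fun j (_ : j ∈ Finset.univ) => hj j
  rw [Finset.sum_add_distrib, Finset.sum_add_distrib, ← Finset.mul_sum, ← Finset.mul_sum,
    ← Finset.mul_sum, hx1, hx2] at hsum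
  rw [he]
  have hd : (∑ j, boxDual γ ν (y (some j))) / √n ≤
      ∑ j, y (some j) * x j + √n * (ν * c₁ + γ * c₂) := by
    rw [div_le_iff₀ hs]
    refine hsum.trans (le_of_eq ?_)
    linear_combination -(γ * c₂) * hsq
  linarith

theorem le_integral_iInf_dot {n : ℕ} (hn : n ≠ 0) (γ ν σ : ℝ) {c₂ c₁ : ℝ} {ι : Type*} [Fintype ι]
    [Nonempty ι] (x : ι → Fin n → ℝ) (hx : ∀ i, x i ∈ feasibleSet n c₂ c₁) :
    √n * (I22 γ ν - I1 γ ν + I21 γ ν - ν * c₁ - γ * c₂) ≤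
      ∫ y : Option (Fin n) → ℝ, (⨅ i, y ⬝ᵥ errorVec σ (x i)) ∂(stdGaussPi (Option (Fin n))) := by
  have hs : 0 < √(n : ℝ) := Real.sqrt_pos.2 (by positivity)
  have iq (j : Fin n) : Integrable (fun y : Option (Fin n) → ℝ => boxDual γ ν (y (some j)))
      (stdGaussPi (Option (Fin n))) :=
    (measurePreserving_eval_gauss (some j)).integrable_comp_of_integrable (integrable_boxDual γ ν)
  have hq (j : Fin n) : ∫ y : Option (Fin n) → ℝ, boxDual γ ν (y (some j))
      ∂(stdGaussPi (Option (Fin n))) = I22 γ ν - I1 γ ν + I21 γ ν := by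
    have mp := measurePreserving_eval_gauss (some j : Option (Fin n))
    rw [← integral_boxDual, ← mp.map_eq, integral_map mp.measurable.aemeasurable
      (by rw [mp.map_eq]; exact (integrable_boxDual γ ν).aestronglyMeasurable)]
  have i1 := (integrable_finsetSum Finset.univ fun j _ => iq j).div_const √(n : ℝ)
  have i2 := i1.sub (integrable_const (√n * (ν * c₁ + γ * c₂)))
  have i3 := integrable_dot (errorVec σ (0 : Fin n → ℝ))
  have h3 : ∫ y : Option (Fin n) → ℝ, y ⬝ᵥ errorVec σ (0 : Fin n → ℝ)
      ∂(stdGaussPi (Option (Fin n))) = 0 := by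
    simp only [dotProduct]
    rw [integral_finsetSum _ fun k _ => (integrable_coord k).mul_const _]
    exact Finset.sum_eq_zero fun k _ => by rw [integral_mul_const, integral_coord, zero_mul]
  have s1 := integral_add i2 i3
  have s2 := integral_sub i1 (integrable_const (√n * (ν * c₁ + γ * c₂)))
  simp only [Pi.sub_apply] at s1
  have e : √n * (I22 γ ν - I1 γ ν + I21 γ ν - ν * c₁ - γ * c₂) =
      ∫ y : Option (Fin n) → ℝ, ((∑ j, boxDual γ ν (y (some j))) / √n - √n * (ν * c₁ + γ * c₂)
        + y ⬝ᵥ errorVec σ (0 : Fin n → ℝ)) ∂(stdGaussPi (Option (Fin n))) := by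
    rw [s1, s2, h3, integral_div, integral_finsetSum _ fun j _ => iq j]
    simp only [hq, Finset.sum_const, Finset.card_univ, Fintype.card_fin, nsmul_eq_mul]
    simp only [integral_const, measureReal_def, measure_univ, ENNReal.toReal_one, one_smul]
    rw [mul_div_right_comm, Real.div_sqrt]
    ring
  rw [e]
  exact integral_mono (i2.add i3) (integrable_iInf fun i => integrable_dot _) fun y =>
    le_ciInf fun i => le_dot_of_mem_feasibleSet hn γ ν σ (hx i) y

/-- The finite-dimensional lower bound for the random primal. -/
theorem le_lintegral_minMaxResidual {m n : ℕ} (hn : n ≠ 0) (γ ν σ : ℝ) {c₂ c₁ : ℝ}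
    (hne : (feasibleSet n c₂ c₁).Nonempty) :
    ENNReal.ofReal (√(1 - 2 * c₁ + c₂ + σ ^ 2) *
        ∫ x : Fin m → ℝ, ‖∑ j, x j • EuclideanSpace.basisFun (Fin m) ℝ j‖ ∂(stdGaussPi (Fin m)) +
      √n * (I22 γ ν - I1 γ ν + I21 γ ν - ν * c₁ - γ * c₂)) ≤
    ∫⁻ p : (Fin m → Fin n → ℝ) × (Fin m → ℝ), minMaxResidual σ c₂ c₁ p.1 p.2
      ∂((gaussMatrix m n).prod (gaussVector m)) := by
  set r := √(1 - 2 * c₁ + c₂ + σ ^ 2)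
  have := hne.to_subtype
  -- Minima over the first `k + 1` points of a dense sequence are finite, so Gordon's inequality
  -- applies to them, and they decrease to a measurable lower bound for `minMaxResidual`, whose own
  -- measurability is never required.
  let d := TopologicalSpace.denseSeq (feasibleSet n c₂ c₁)
  have hr (x : feasibleSet n c₂ c₁) : errorVec σ (x : Fin n → ℝ) ⬝ᵥ errorVec σ (x : Fin n → ℝ) =
      r ^ 2 := by
    have h := errorVec_dot_self hn σ x.2
    have h0 : 0 ≤ errorVec σ (x : Fin n → ℝ) ⬝ᵥ errorVec σ (x : Fin n → ℝ) :=
      Finset.sum_nonneg fun k _ => mul_self_nonneg _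
    rw [h] at h0 ⊢
    rw [Real.sq_sqrt h0]
  let H (x : Fin n → ℝ) (X : Fin m × Option (Fin n) → ℝ) : ℝ :=
    ‖∑ jk, X jk • errorVec σ x jk.2 • EuclideanSpace.basisFun (Fin m) ℝ jk.1‖
  have hHc (X) : Continuous fun x : feasibleSet n c₂ c₁ => H x X := by
    have (k : Option (Fin n)) : Continuous fun x : feasibleSet n c₂ c₁ =>
        errorVec σ (x : Fin n → ℝ) k := by
      cases k with
      | none => exact continuous_const
      | some j => exact ((continuous_apply j).comp continuous_subtype_val).sub continuous_const
    simp only [H]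
    fun_prop
  have hHi (x) : Integrable (H x) (stdGaussPi _) := integrable_norm_sum_smul _
  let G (k : ℕ) (X : Fin m × Option (Fin n) → ℝ) : ℝ := ⨅ i : Fin (k + 1), H (d i) X
  have hG0 (k X) : 0 ≤ G k X := Real.iInf_nonneg fun i => norm_nonneg _
  have hGi (k) : Integrable (G k) (stdGaussPi _) := integrable_iInf fun i => hHi _
  have hGm (k) : Measurable (G k) := by
    refine Measurable.iInf fun i => Continuous.measurable ?_
    simp only [H]; fun_prop
  have hbound (k : ℕ) : ENNReal.ofReal (r * ∫ x : Fin m → ℝ,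
      ‖∑ j, x j • EuclideanSpace.basisFun (Fin m) ℝ j‖ ∂(stdGaussPi (Fin m)) +
      √n * (I22 γ ν - I1 γ ν + I21 γ ν - ν * c₁ - γ * c₂)) ≤
      ∫⁻ X, ENNReal.ofReal (G k X) ∂(stdGaussPi (Fin m × Option (Fin n))) := by
    rw [← ofReal_integral_eq_lintegral_ofReal (hGi k) (Eventually.of_forall (hG0 k))]
    refine ENNReal.ofReal_le_ofReal ?_
    refine le_trans ?_ (gordon_comparison (EuclideanSpace.basisFun (Fin m) ℝ)
      (z := fun i : Fin (k + 1) => errorVec σ (d i : Fin n → ℝ)) (Real.sqrt_nonneg _)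
      fun i => hr (d i))
    gcongr
    exact le_integral_iInf_dot hn γ ν σ (fun i : Fin (k + 1) => (d i : Fin n → ℝ)) fun i => (d i).2
  have hanti : Antitone fun k X => ENNReal.ofReal (G k X) := by
    intro k l hkl X
    refine ENNReal.ofReal_le_ofReal (le_ciInf fun i => ?_)
    exact ciInf_le_of_le (Set.finite_range _).bddBelow (Fin.castLE (by omega) i) le_rfl
  have hinf : ∫⁻ X, (⨅ k, ENNReal.ofReal (G k X)) ∂(stdGaussPi (Fin m × Option (Fin n))) ≤
      ∫⁻ p : (Fin m → Fin n → ℝ) × (Fin m → ℝ), minMaxResidual σ c₂ c₁ p.1 p.2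
        ∂((gaussMatrix m n).prod (gaussVector m)) := by
    have hmeas : Measurable fun X => ⨅ k, ENNReal.ofReal (G k X) :=
      Measurable.iInf fun k => (hGm k).ennreal_ofReal
    rw [← (measurePreserving_joinEntries m n).lintegral_comp hmeas]
    refine lintegral_mono fun p => le_iInf₂ fun x hx => ?_
    have h1 : ⨅ k, ENNReal.ofReal (G k (joinEntries p)) ≤
        ENNReal.ofReal (H x (joinEntries p)) := by
      have hcl : IsClosed {x : feasibleSet n c₂ c₁ | ⨅ k, ENNReal.ofReal (G k (joinEntries p)) ≤
          ENNReal.ofReal (H x (joinEntries p))} :=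
        isClosed_le continuous_const (ENNReal.continuous_ofReal.comp (hHc _))
      have hdense := TopologicalSpace.denseRange_denseSeq (feasibleSet n c₂ c₁)
      have hall := hdense.induction_on (p := fun x : feasibleSet n c₂ c₁ =>
        ⨅ k, ENNReal.ofReal (G k (joinEntries p)) ≤ ENNReal.ofReal (H x (joinEntries p)))
        ⟨x, hx⟩ hcl fun k => ?_
      · exact hall
      · exact (iInf_le _ k).trans (ENNReal.ofReal_le_ofReal
          (ciInf_le_of_le (Set.finite_range _).bddBelow (Fin.last k) le_rfl))
    exact h1.trans (ENNReal.ofReal_le_ofReal (norm_sum_joinEntries σ p x))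
  refine le_trans ?_ hinf
  rw [lintegral_iInf (fun k => (hGm k).ennreal_ofReal) hanti
    ((hGi 0).lintegral_lt_top).ne]
  exact le_iInf hbound

theorem ofReal_le_xiPrimalN {m n : ℕ} (hm : m ≠ 0) (hn : n ≠ 0) (σ c₂ c₁ γ ν : ℝ) :
    ENNReal.ofReal (√((m : ℝ) / n) * (1 - Var[fun x => x ^ 2; gaussianReal 0 1] / 2 / m) *
        √(1 - 2 * c₁ + c₂ + σ ^ 2) + (I22 γ ν - I1 γ ν + I21 γ ν - ν * c₁ - γ * c₂)) ≤
      xiPrimalN m n σ c₂ c₁ := by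
  have hn' : 0 < (n : ℝ) := by positivity
  have hs : 0 < √(n : ℝ) := Real.sqrt_pos.2 hn'
  rw [xiPrimalN]
  rcases (feasibleSet n c₂ c₁).eq_empty_or_nonempty with he | hne
  -- An empty feasible set makes the primal infinite. This includes every negative radicand, which
  -- could not be the squared norm of `errorVec`.
  · have htop : ∀ p : (Fin m → Fin n → ℝ) × (Fin m → ℝ), minMaxResidual σ c₂ c₁ p.1 p.2 = ⊤ := by
      intro p; simp [minMaxResidual, he]
    have : IsProbabilityMeasure ((gaussMatrix m n).prod (gaussVector m)) := by
      unfold gaussMatrix gaussVector; infer_instance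
    simp only [htop, lintegral_const, measure_univ, mul_one]
    rw [ENNReal.mul_top (by simpa using Nat.pos_of_ne_zero hn)]
    exact le_top
  · refine le_trans ?_ (mul_le_mul_right (le_lintegral_minMaxResidual hn γ ν σ hne) _)
    rw [← ENNReal.ofReal_mul (by positivity)]
    refine ENNReal.ofReal_le_ofReal ?_
    have : Nonempty (Fin m) := ⟨⟨0, Nat.pos_of_ne_zero hm⟩⟩
    have h := sqrt_mul_le_integral_norm (τ := Fin m)
    rw [Fintype.card_fin] at h
    have h2 := mul_le_mul_of_nonneg_left h
      (mul_nonneg (by positivity : 0 ≤ 1 / √(n : ℝ)) (Real.sqrt_nonneg (1 - 2 * c₁ + c₂ + σ ^ 2)))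
    have e : 1 / √(n : ℝ) * (√n * (I22 γ ν - I1 γ ν + I21 γ ν - ν * c₁ - γ * c₂)) =
        I22 γ ν - I1 γ ν + I21 γ ν - ν * c₁ - γ * c₂ := by
      rw [← mul_assoc, one_div_mul_cancel hs.ne', one_mul]
    rw [mul_add, e, Real.sqrt_div (by positivity)]
    refine add_le_add_left (le_trans (le_of_eq ?_) (h2.trans (le_of_eq ?_))) _ <;> ring

theorem xiRD_le_xiPrimal {α : ℝ} (hα : 0 < α) {m : ℕ → ℕ}
    (hm : Tendsto (fun n : ℕ => (m n : ℝ) / (n : ℝ)) atTop (𝓝 α)) (σ c₂ c₁ γ ν : ℝ) :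
    (xiRD α σ c₂ c₁ γ ν : EReal) ≤ (xiPrimal m σ c₂ c₁ : EReal) := by
  set K := Var[fun x => x ^ 2; gaussianReal 0 1] / 2
  have hmtop : Tendsto (fun n => (m n : ℝ)) atTop atTop := by
    refine (hm.pos_mul_atTop hα tendsto_natCast_atTop_atTop).congr' ?_
    filter_upwards [eventually_ne_atTop 0] with n hn
    have : (n : ℝ) ≠ 0 := by exact_mod_cast hn
    field_simp
  have hb : Tendsto (fun n : ℕ => √((m n : ℝ) / n) * (1 - K / m n) *
      √(1 - 2 * c₁ + c₂ + σ ^ 2) + (I22 γ ν - I1 γ ν + I21 γ ν - ν * c₁ - γ * c₂)) atTop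
      (𝓝 (xiRD α σ c₂ c₁ γ ν)) := by
    have h := ((hm.sqrt.mul ((hmtop.const_div_atTop K).const_sub 1)).mul_const
      √(1 - 2 * c₁ + c₂ + σ ^ 2)).add_const (I22 γ ν - I1 γ ν + I21 γ ν - ν * c₁ - γ * c₂)
    convert h using 2
    rw [xiRD]; ring
  -- Truncating at `0` is harmless: the primal is nonnegative, and `xiRD` is at most its positive
  -- part.
  have hle : ENNReal.ofReal (xiRD α σ c₂ c₁ γ ν) ≤ xiPrimal m σ c₂ c₁ := by
    rw [xiPrimal, ← ((ENNReal.continuous_ofReal.tendsto _).comp hb).liminf_eq]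
    refine liminf_le_liminf ?_
    filter_upwards [eventually_ne_atTop 0, hmtop.eventually_gt_atTop 0] with n hn hmn
    exact ofReal_le_xiPrimalN (by exact_mod_cast hmn.ne') hn σ c₂ c₁ γ ν
  refine le_trans ?_ (EReal.coe_ennreal_le_coe_ennreal_iff.2 hle)
  rw [EReal.coe_ennreal_ofReal]
  exact EReal.coe_le_coe_iff.2 (le_max_left _ _)

theorem theorem1 (α : ℝ) (hα : 0 < α) (m : ℕ → ℕ)
    (hm : Tendsto (fun n : ℕ => (m n : ℝ) / (n : ℝ)) atTop (𝓝 α)) (σ c₂ : ℝ) :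
    (∀ c₁ : ℝ,
      (⨆ γ : ℝ, ⨆ ν : ℝ, (xiRD α σ c₂ c₁ γ ν : EReal)) ≤ (xiPrimal m σ c₂ c₁ : EReal)) ∧
    (∀ C : Set ℝ,
      (⨅ c₁ ∈ C, ⨆ γ : ℝ, ⨆ ν : ℝ, (xiRD α σ c₂ c₁ γ ν : EReal)) ≤
        ⨅ c₁ ∈ C, (xiPrimal m σ c₂ c₁ : EReal)) := by
  have h (c₁ : ℝ) : (⨆ γ : ℝ, ⨆ ν : ℝ, (xiRD α σ c₂ c₁ γ ν : EReal)) ≤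
      (xiPrimal m σ c₂ c₁ : EReal) :=
    iSup₂_le fun γ ν => xiRD_le_xiPrimal hα hm σ c₂ c₁ γ ν
  exact ⟨h, fun C => iInf₂_mono fun c₁ _ => h c₁⟩
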